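/- Let $\mathbb{R}^{2,2}$ be $\mathbb{R}^4$ with the form $\langle x,y\rangle=x_1y_1+x_2y_2-x_3y_3-x_4y_4$, let $\mathbb{A}\mathrm{d}\mathbb{S}^3=\mathrm{P}\{\langle x,x\rangle<0\}\subset\mathbb{R}\mathrm{P}^3$, with double cover $\widehat{\mathbb{A}\mathrm{d}\mathbb{S}^3}=\{\langle x,x\rangle=-1\}$, and let $\partial_\infty\mathbb{A}\mathrm{d}\mathbb{S}^3=\mathrm{P}\{\langle x,x\rangle=0\}$, a quadric with two rulings by lines, called left and right. Let $S\subset\mathbb{A}\mathrm{d}\mathbb{S}^3$ be a smooth embedded spacelike surface that lifts to $\widehat{\mathbb{A}\mathrm{d}\mathbb{S}^3}$ (for example, a simply connected one), with unit normal field $N$ and shape operator $B(v)=\nabla_vN$. Assume that $S$ is maximal, that is, $\mathrm{tr}\,B=0$; let $\pm\lambda(x)$ be the eigenvalues of $B$ at $x$, and let $\|\lambda\|_\infty=\sup_{x\in S}|\lambda(x)|$. Call $S$ entire if it is a topological disc and $\overline S\setminus S\subset\partial_\infty\mathbb{A}\mathrm{d}\mathbb{S}^3$, the closure being taken in $\mathbb{R}\mathrm{P}^3$.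 Fix a totally geodesic spacelike plane $P$ in $\mathbb{A}\mathrm{d}\mathbb{S}^3$, which is a copy of $\mathbb{H}^2$. For $x\in S$ let $\Phi_l(x)\in P$ be the image of $x$ under an isometry of $\mathbb{A}\mathrm{d}\mathbb{S}^3$ which moves every point of $\partial_\infty\mathbb{A}\mathrm{d}\mathbb{S}^3$ along the line of the left ruling through it and which maps the totally geodesic plane tangent to $S$ at $x$ onto $P$ (there is exactly one such isometry); let $\Phi_r(x)\in P$ be defined in the same way with the right ruling. For a map $\Phi:P\to P$ that is differentiable at $y$, the quasiconformal distortion $K(y)$ is the ratio of $\sup\|d_y\Phi(v)\|$ to $\inf\|d_y\Phi(v)\|$ over unit vectors $v\in T_yP$; the maximal dilatation is $K(\Phi)=\sup_{y\in P}K(y)\in[1,\infty]$. (1) If $S$ is entire and $\|\lambda\|_\infty<1$, then $\Phi_l$ and $\Phi_r$ are bijections from $S$ to $P$. Hence the minimal Lagrangian map $\Phi_{M\!L}=\Phi_r\circ\Phi_l^{-1}:P\to P$ associated with $S$ is defined. (2) More generally, for any $S$ as above, let $\Phi:P\to P$ be a map with $\Phi\circ\Phi_l=\Phi_r$. Then,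 at every $x\in S$ with $|\lambda(x)|<1$, the map $\Phi$ is differentiable at $y=\Phi_l(x)$ and $$K(y)=\left(\frac{1+|\lambda(x)|}{1-|\lambda(x)|}\right)^2 .$$ If moreover $|\lambda|<1$ on all of $S$ and $\Phi_l$ is surjective, then $$K(\Phi)=\left(\frac{1+\|\lambda\|_\infty}{1-\|\lambda\|_\infty}\right)^2,$$ where the right-hand side is $+\infty$ if $\|\lambda\|_\infty=1$. In particular, for an entire maximal surface with $\|\lambda\|_\infty<1$ both formulas hold for $\Phi=\Phi_{M\!L}$, the first one at every $x\in S$. -/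

import Mathlib

open scoped Manifold ContDiff ENNReal LinearAlgebra.Projectivization

noncomputable section

namespace AdSMaximal

/-! ### Anti-de Sitter space -/

/-- The vector space underlying `ℝ^{2,2}`. -/
abbrev R22 : Type := Fin 4 → ℝ

/-- The parameter plane on which surfaces are modelled. -/
abbrev E2 : Type := EuclideanSpace ℝ (Fin 2)

/-- The bilinear form of signature `(2,2)`. -/
def form (x y : R22) : ℝ := x 0 * y 0 + x 1 * y 1 - x 2 * y 2 - x 3 * y 3

/-- The double cover of Anti-de Sitter space: vectors of square `-1`. -/
def AdSHat : Set R22 := {x | form x x = -1}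

theorem ne_zero_of_mem {x : R22} (hx : x ∈ AdSHat) : x ≠ 0 := by
  rintro rfl
  simp [AdSHat, form] at hx

/-- The quotient topology of real projective 3-space. -/
instance : TopologicalSpace (ℙ ℝ R22) :=
  TopologicalSpace.coinduced (fun v : {v : R22 // v ≠ 0} => Projectivization.mk ℝ v.1 v.2)
    inferInstance

/-- Anti-de Sitter space, as a domain of real projective 3-space. -/
def AdS : Set (ℙ ℝ R22) := {p | form p.rep p.rep < 0}

/-- The boundary at infinity of Anti-de Sitter space, a doubly ruled quadric. -/
def boundaryAdS : Set (ℙ ℝ R22) := {p | form p.rep p.rep = 0}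

/-- The vector field `(x₁,x₂,x₃,x₄) ↦ (0,0,-x₄,x₃)` on `AdSHat`. It is timelike and tangent, and
it defines the time orientation for which `(0,0,0,1)` at `(0,0,1,0)` is future-directed. -/
def timeField (x : R22) : R22 := ![0, 0, -x 3, x 2]

/-- The linear hyperplane orthogonal to `p` for the form of signature `(2,2)`. -/
def perp (p : R22) : Submodule ℝ R22 where
  carrier := {w | form w p = 0}
  zero_mem' := by simp [form]
  add_mem' := by
    intro a b ha hb
    simp only [Set.mem_ofPred_eq, form, Pi.add_apply] at *
    linarith
  smul_mem' := by
    intro c a ha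
    simp only [Set.mem_ofPred_eq, form, Pi.smul_apply, smul_eq_mul] at *
    linear_combination c * ha

/-- The totally geodesic spacelike plane dual to `p₀ ∈ AdSHat`, a copy of the hyperbolic plane.
A point of it is the class `[y]` of exactly two opposite vectors `y` with `⟨y,y⟩ = -1` and
`⟨y,p₀⟩ = 0`; it is represented here by the one that is future-directed at `p₀`. So this is the
hyperboloid model of the hyperbolic plane inside `p₀^⊥`, and its tangent space at `y` is
`{v | ⟨v,y⟩ = 0 and ⟨v,p₀⟩ = 0}` with the restricted form as Riemannian metric. -/
def plane (p₀ : R22) : Set R22 :=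
  {y | form y y = -1 ∧ form y p₀ = 0 ∧ form y (timeField p₀) < 0}

/-! ### The two rulings of the boundary at infinity -/

/-- The identification of `ℝ^{2,2}` with 2×2 matrices, under which `⟨x,x⟩ = -det`. -/
def toMat : R22 ≃ₗ[ℝ] Matrix (Fin 2) (Fin 2) ℝ where
  toFun x := !![x 2 + x 0, x 1 + x 3; x 1 - x 3, x 2 - x 0]
  map_add' x y := by
    ext i j; fin_cases i <;> fin_cases j <;> simp <;> ring
  map_smul' c x := by
    ext i j; fin_cases i <;> fin_cases j <;> simp <;> ring
  invFun A := ![(A 0 0 - A 1 1) / 2, (A 0 1 + A 1 0) / 2, (A 0 0 + A 1 1) / 2, (A 0 1 - A 1 0) / 2]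
  left_inv x := by
    ext i; fin_cases i <;> simp
  right_inv A := by
    ext i j; fin_cases i <;> fin_cases j <;> simp <;> ring

theorem form_self (x : R22) : form x x = -(toMat x).det := by
  simp [form, toMat, Matrix.det_fin_two]
  ring

/-- `ξ` and `η` lie on a common line of the left ruling. The lines of the left ruling of the
quadric `P{det = 0}` are the sets of matrices that annihilate a given column vector. -/
def SameLeftLine (ξ η : R22) : Prop :=
  ∃ k : Fin 2 → ℝ, k ≠ 0 ∧ (toMat ξ).mulVec k = 0 ∧ (toMat η).mulVec k = 0

/-- `ξ` and `η` lie on a common line of the right ruling. The lines of the right ruling of the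
quadric `P{det = 0}` are the sets of matrices that annihilate a given row vector. -/
def SameRightLine (ξ η : R22) : Prop :=
  ∃ k : Fin 2 → ℝ, k ≠ 0 ∧ Matrix.vecMul k (toMat ξ) = 0 ∧ Matrix.vecMul k (toMat η) = 0

/-- `g` is a linear isometry of `ℝ^{2,2}`; it induces an isometry of Anti-de Sitter space. -/
def IsIsometry (g : R22 ≃ₗ[ℝ] R22) : Prop := ∀ x y, form (g x) (g y) = form x y

/-- `g` is an isometry that moves each point at infinity along its line of the left ruling. -/
def FollowsLeft (g : R22 ≃ₗ[ℝ] R22) : Prop :=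
  IsIsometry g ∧ ∀ ξ, form ξ ξ = 0 → SameLeftLine ξ (g ξ)

/-- `g` is an isometry that moves each point at infinity along its line of the right ruling. -/
def FollowsRight (g : R22 ≃ₗ[ℝ] R22) : Prop :=
  IsIsometry g ∧ ∀ ξ, form ξ ξ = 0 → SameRightLine ξ (g ξ)

/-! ### Spacelike surfaces -/

/-- A smooth embedded spacelike surface in Anti-de Sitter space, with a unit normal field.
The embedding `M → AdS` is `x ↦ [σ x]`, for a smooth lift `σ` of it to the double cover. A lift
exists whenever `M` is simply connected, for instance a topological disc. -/
structure SpacelikeSurface (M : Type*) [TopologicalSpace M] [ChartedSpace E2 M]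
    [IsManifold 𝓘(ℝ, E2) ∞ M] where
  /-- the lift of the embedding to the double cover -/
  σ : M → R22
  /-- the unit normal field -/
  N : M → R22
  smooth_σ : ContMDiff 𝓘(ℝ, E2) 𝓘(ℝ, R22) ∞ σ
  smooth_N : ContMDiff 𝓘(ℝ, E2) 𝓘(ℝ, R22) ∞ N
  mem : ∀ x, σ x ∈ AdSHat
  embedding : Topology.IsEmbedding
    (fun x => Projectivization.mk ℝ (σ x) (ne_zero_of_mem (mem x)))
  spacelike : ∀ x (v : TangentSpace 𝓘(ℝ, E2) x), v ≠ 0 →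
    0 < form (mfderiv 𝓘(ℝ, E2) 𝓘(ℝ, R22) σ x v) (mfderiv 𝓘(ℝ, E2) 𝓘(ℝ, R22) σ x v)
  normal_unit : ∀ x, form (N x) (N x) = -1
  normal_tangent_AdS : ∀ x, form (N x) (σ x) = 0
  normal_orthogonal : ∀ x (v : TangentSpace 𝓘(ℝ, E2) x),
    form (N x) (mfderiv 𝓘(ℝ, E2) 𝓘(ℝ, R22) σ x v) = 0

namespace SpacelikeSurface

variable {M : Type*} [TopologicalSpace M] [ChartedSpace E2 M] [IsManifold 𝓘(ℝ, E2) ∞ M]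

/-- The differential of the immersion at `x`, as a linear map from `T_x M`. -/
def dσ (S : SpacelikeSurface M) (x : M) : TangentSpace 𝓘(ℝ, E2) x →ₗ[ℝ] R22 :=
  (mfderiv 𝓘(ℝ, E2) 𝓘(ℝ, R22) S.σ x).toLinearMap

/-- The flat derivative in `ℝ^{2,2}` of the unit normal field at `x`. -/
def dN (S : SpacelikeSurface M) (x : M) : TangentSpace 𝓘(ℝ, E2) x →ₗ[ℝ] R22 :=
  (mfderiv 𝓘(ℝ, E2) 𝓘(ℝ, R22) S.N x).toLinearMap

/-- The orthogonal projection of `ℝ^{2,2}` to `T_p AdSHat = p^⊥`, for `p ∈ AdSHat`. -/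
def tangentProj (p : R22) : R22 →ₗ[ℝ] R22 where
  toFun w := w + form w p • p
  map_add' a b := by
    ext i; simp [form]; ring
  map_smul' c a := by
    ext i; simp [form]; ring

/-- The shape operator `B(v) = ∇_v N` on `T_x M`. The ambient connection `∇` is the tangential
part of the flat one; as `∇_v N` is tangent to the surface, it is pulled back to `T_x M` by the
inverse of the injective differential of the immersion. -/
def shapeOperator (S : SpacelikeSurface M) (x : M) : Module.End ℝ (TangentSpace 𝓘(ℝ, E2) x) :=
  (S.dσ x).leftInverse ∘ₗ tangentProj (S.σ x) ∘ₗ S.dN x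

/-- Maximal surfaces: the shape operator is traceless. -/
def IsMaximal (S : SpacelikeSurface M) : Prop :=
  ∀ x, LinearMap.trace ℝ (TangentSpace 𝓘(ℝ, E2) x) (S.shapeOperator x) = 0

/-- The surface as a subset of projective space. -/
def image (S : SpacelikeSurface M) : Set (ℙ ℝ R22) :=
  Set.range fun x => Projectivization.mk ℝ (S.σ x) (ne_zero_of_mem (S.mem x))

/-- Entire surfaces: topological discs with frontier contained in the boundary at infinity. -/
def IsEntire (S : SpacelikeSurface M) : Prop :=
  Nonempty (M ≃ₜ Metric.ball (0 : E2) 1) ∧ closure S.image \ S.image ⊆ boundaryAdS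

/-- The linear hyperplane of `ℝ^{2,2}` whose projectivization is the totally geodesic plane
tangent to the surface at `x`. -/
def tangentPlane (S : SpacelikeSurface M) (x : M) : Submodule ℝ R22 :=
  Submodule.span ℝ {S.σ x} ⊔ LinearMap.range (S.dσ x)

end SpacelikeSurface

/-! ### The left and right maps -/

theorem det_eq_one {p : R22} (hp : form p p = -1) : (toMat p).det = 1 := by
  have := form_self p
  linarith

theorem form_polar (x y : R22) :
    form x y = (form (x + y) (x + y) - form x x - form y y) / 2 := by
  simp only [form, Pi.add_apply]
  ring

theorem isIsometry_of_det {g : R22 ≃ₗ[ℝ] R22} (h : ∀ x, (toMat (g x)).det = (toMat x).det) :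
    IsIsometry g := by
  intro x y
  rw [form_polar (g x), form_polar x, ← map_add]
  simp only [form_self, h]

theorem exists_mul_left (A : Matrix (Fin 2) (Fin 2) ℝ) (hA : A.det = 1) :
    ∃ g : R22 ≃ₗ[ℝ] R22, FollowsLeft g ∧ ∀ x, toMat (g x) = A * toMat x := by
  have hu : IsUnit A.det := by rw [hA]; exact isUnit_one
  let g : R22 ≃ₗ[ℝ] R22 := toMat ≪≫ₗ LinearEquiv.ofLinearMap (LinearMap.mulLeft ℝ A)
    (LinearMap.mulLeft ℝ A⁻¹)
    (by ext1 X; simp [Matrix.mul_nonsing_inv_cancel_left _ _ hu])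
    (by ext1 X; simp [Matrix.nonsing_inv_mul_cancel_left _ _ hu]) ≪≫ₗ toMat.symm
  have hg : ∀ x, toMat (g x) = A * toMat x := fun x => by simp [g]
  refine ⟨g, ⟨isIsometry_of_det fun x => by rw [hg, Matrix.det_mul, hA, one_mul], ?_⟩, hg⟩
  intro ξ hξ
  rw [form_self, neg_eq_zero] at hξ
  obtain ⟨k, hk, hk0⟩ := Matrix.exists_mulVec_eq_zero_iff.mpr hξ
  exact ⟨k, hk, hk0, by rw [hg, ← Matrix.mulVec_mulVec, hk0, Matrix.mulVec_zero]⟩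

theorem exists_mul_right (A : Matrix (Fin 2) (Fin 2) ℝ) (hA : A.det = 1) :
    ∃ g : R22 ≃ₗ[ℝ] R22, FollowsRight g ∧ ∀ x, toMat (g x) = toMat x * A := by
  have hu : IsUnit A.det := by rw [hA]; exact isUnit_one
  let g : R22 ≃ₗ[ℝ] R22 := toMat ≪≫ₗ LinearEquiv.ofLinearMap (LinearMap.mulRight ℝ A)
    (LinearMap.mulRight ℝ A⁻¹)
    (by ext1 X; simp [Matrix.nonsing_inv_mul_cancel_right _ _ hu])
    (by ext1 X; simp [Matrix.mul_nonsing_inv_cancel_right _ _ hu]) ≪≫ₗ toMat.symm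
  have hg : ∀ x, toMat (g x) = toMat x * A := fun x => by simp [g]
  refine ⟨g, ⟨isIsometry_of_det fun x => by rw [hg, Matrix.det_mul, hA, mul_one], ?_⟩, hg⟩
  intro ξ hξ
  rw [form_self, neg_eq_zero] at hξ
  obtain ⟨k, hk, hk0⟩ := Matrix.exists_vecMul_eq_zero_iff.mpr hξ
  exact ⟨k, hk, hk0, by rw [hg, ← Matrix.vecMul_vecMul, hk0, Matrix.zero_vecMul]⟩

theorem FollowsLeft.neg {g : R22 ≃ₗ[ℝ] R22} (h : FollowsLeft g) :
    FollowsLeft (g ≪≫ₗ LinearEquiv.neg ℝ) := by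
  refine ⟨fun x y => ?_, fun ξ hξ => ?_⟩
  · rw [← h.1 x y]; simp [form]
  · obtain ⟨k, hk, h1, h2⟩ := h.2 ξ hξ
    exact ⟨k, hk, h1, by simp [Matrix.neg_mulVec, h2]⟩

theorem FollowsRight.neg {g : R22 ≃ₗ[ℝ] R22} (h : FollowsRight g) :
    FollowsRight (g ≪≫ₗ LinearEquiv.neg ℝ) := by
  refine ⟨fun x y => ?_, fun ξ hξ => ?_⟩
  · rw [← h.1 x y]; simp [form]
  · obtain ⟨k, hk, h1, h2⟩ := h.2 ξ hξ
    exact ⟨k, hk, h1, by simp [Matrix.vecMul_neg, h2]⟩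

theorem form_timeField_ne_zero {p y : R22} (hp : form p p = -1) (hy : form y y = -1)
    (hyp : form y p = 0) : form y (timeField p) ≠ 0 := by
  intro h
  simp only [form, timeField] at hp hy hyp h
  simp at h
  have h1 : (y 0 * p 0 + y 1 * p 1) ^ 2 = (y 2 ^ 2 + y 3 ^ 2) * (p 2 ^ 2 + p 3 ^ 2) := by
    have e : y 0 * p 0 + y 1 * p 1 = y 2 * p 2 + y 3 * p 3 := by linarith
    have h' : y 2 * p 3 - y 3 * p 2 = 0 := by linarith
    rw [e]
    linear_combination (-(y 2 * p 3 - y 3 * p 2)) * h'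
  have e1 : y 2 ^ 2 + y 3 ^ 2 = y 0 ^ 2 + y 1 ^ 2 + 1 := by linarith
  have e2 : p 2 ^ 2 + p 3 ^ 2 = p 0 ^ 2 + p 1 ^ 2 + 1 := by linarith
  rw [e1, e2] at h1
  nlinarith [sq_nonneg (y 0 * p 1 - y 1 * p 0), sq_nonneg (y 0), sq_nonneg (y 1),
    sq_nonneg (p 0), sq_nonneg (p 1)]

namespace SpacelikeSurface

variable {M : Type*} [TopologicalSpace M] [ChartedSpace E2 M] [IsManifold 𝓘(ℝ, E2) ∞ M]

theorem tangentPlane_eq (S : SpacelikeSurface M) (x : M) : S.tangentPlane x = perp (S.N x) := by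
  have comm : ∀ a b : R22, form a b = form b a := fun a b => by simp only [form]; ring
  have hle : S.tangentPlane x ≤ perp (S.N x) := by
    refine sup_le ((Submodule.span_singleton_le_iff_mem _ _).2 ?_) ?_
    · exact (comm _ _).trans (S.normal_tangent_AdS x)
    · rintro _ ⟨v, rfl⟩
      exact (comm _ _).trans (S.normal_orthogonal x v)
  have hN : perp (S.N x) < ⊤ := by
    refine lt_top_iff_ne_top.2 fun h => ?_
    have : S.N x ∈ perp (S.N x) := h ▸ Submodule.mem_top
    have h2 : form (S.N x) (S.N x) = 0 := this
    rw [S.normal_unit] at h2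
    norm_num at h2
  have hinj : Function.Injective (S.dσ x) := by
    rw [injective_iff_map_eq_zero]
    intro v hv
    by_contra hne
    have := S.spacelike x v hne
    change 0 < form (S.dσ x v) (S.dσ x v) at this
    rw [hv] at this
    simp [form] at this
  have hlt : LinearMap.range (S.dσ x) < S.tangentPlane x := by
    refine lt_of_le_of_ne le_sup_right fun h => ?_
    have hm : S.σ x ∈ LinearMap.range (S.dσ x) := by
      rw [h]
      exact (le_sup_left : _ ≤ S.tangentPlane x) (Submodule.mem_span_singleton_self _)
    obtain ⟨v, hv⟩ := hm
    have h1 : form (S.σ x) (S.σ x) = -1 := S.mem x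
    by_cases h0 : v = 0
    · rw [h0, map_zero] at hv
      exact ne_zero_of_mem (S.mem x) hv.symm
    · have := S.spacelike x v h0
      change 0 < form (S.dσ x v) (S.dσ x v) at this
      rw [hv, h1] at this
      norm_num at this
  have r : Module.finrank ℝ (LinearMap.range (S.dσ x)) = 2 := by
    rw [LinearMap.finrank_range_of_inj hinj]
    exact finrank_euclideanSpace_fin
  have a1 := Submodule.finrank_lt_finrank_of_lt hlt
  have a2 := Submodule.finrank_lt_finrank_of_lt hN
  have a3 : Module.finrank ℝ (⊤ : Submodule ℝ R22) = 4 := by simp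
  exact Submodule.eq_of_le_of_finrank_le hle (by omega)

theorem map_tangentPlane (S : SpacelikeSurface M) (x : M) {p₀ : R22} {g : R22 ≃ₗ[ℝ] R22}
    (hg : IsIsometry g) (h : g (S.N x) = p₀) :
    (S.tangentPlane x).map g.toLinearMap = perp p₀ := by
  rw [tangentPlane_eq]
  ext w
  constructor
  · rintro ⟨u, hu, rfl⟩
    change form (g u) p₀ = 0
    rw [← h, hg]
    exact hu
  · intro hw
    refine ⟨g.symm w, ?_, by simp⟩
    change form (g.symm w) (S.N x) = 0
    rw [← hg, h, g.apply_symm_apply]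
    exact hw

theorem map_neg_tangentPlane (S : SpacelikeSurface M) (x : M) {p₀ : R22} {g : R22 ≃ₗ[ℝ] R22}
    (h : (S.tangentPlane x).map g.toLinearMap = perp p₀) :
    (S.tangentPlane x).map (g ≪≫ₗ LinearEquiv.neg ℝ).toLinearMap = perp p₀ := by
  rw [← h]
  ext w
  constructor
  · rintro ⟨u, hu, rfl⟩
    exact ⟨-u, neg_mem hu, by simp⟩
  · rintro ⟨u, hu, rfl⟩
    exact ⟨-u, neg_mem hu, by simp⟩

/-- There is an isometry `g` following the left ruling which maps the plane tangent to `S` at `x`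
to the plane dual to `p₀` (it is unique up to sign); of the two opposite vectors representing the
image of the point `x`, one lies in `plane p₀`. -/
theorem exists_left (S : SpacelikeSurface M) (p₀ : AdSHat) (x : M) :
    ∃ y ∈ plane p₀, ∃ g : R22 ≃ₗ[ℝ] R22, FollowsLeft g ∧
      (S.tangentPlane x).map g.toLinearMap = perp p₀ ∧ g (S.σ x) = y := by
  have hp : form p₀.1 p₀.1 = -1 := p₀.2
  have hNd := det_eq_one (S.normal_unit x)
  obtain ⟨g, hg, hm⟩ := exists_mul_left (toMat p₀.1 * (toMat (S.N x))⁻¹) (by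
    rw [Matrix.det_mul, det_eq_one hp, Matrix.det_nonsing_inv, hNd]; simp)
  have hgN : g (S.N x) = p₀.1 := toMat.injective (by
    rw [hm, Matrix.nonsing_inv_mul_cancel_right _ _ (by rw [hNd]; exact isUnit_one)])
  have h1 : form (g (S.σ x)) (g (S.σ x)) = -1 := (hg.1 _ _).trans (S.mem x)
  have h2 : form (g (S.σ x)) p₀.1 = 0 := by
    rw [← hgN, hg.1]
    have := S.normal_tangent_AdS x
    simp only [form] at *; linarith
  have hmap := S.map_tangentPlane x hg.1 hgN
  rcases lt_or_gt_of_ne (form_timeField_ne_zero hp h1 h2) with h | h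
  · exact ⟨_, ⟨h1, h2, h⟩, g, hg, hmap, rfl⟩
  · refine ⟨-g (S.σ x), ⟨?_, ?_, ?_⟩, _, hg.neg, S.map_neg_tangentPlane x hmap, by simp⟩
    all_goals simp only [form, Pi.neg_apply] at *; linarith

/-- The analogue of `exists_left` for the right ruling. -/
theorem exists_right (S : SpacelikeSurface M) (p₀ : AdSHat) (x : M) :
    ∃ y ∈ plane p₀, ∃ g : R22 ≃ₗ[ℝ] R22, FollowsRight g ∧
      (S.tangentPlane x).map g.toLinearMap = perp p₀ ∧ g (S.σ x) = y := by
  have hp : form p₀.1 p₀.1 = -1 := p₀.2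
  have hNd := det_eq_one (S.normal_unit x)
  obtain ⟨g, hg, hm⟩ := exists_mul_right ((toMat (S.N x))⁻¹ * toMat p₀.1) (by
    rw [Matrix.det_mul, det_eq_one hp, Matrix.det_nonsing_inv, hNd]; simp)
  have hgN : g (S.N x) = p₀.1 := toMat.injective (by
    rw [hm, Matrix.mul_nonsing_inv_cancel_left _ _ (by rw [hNd]; exact isUnit_one)])
  have h1 : form (g (S.σ x)) (g (S.σ x)) = -1 := (hg.1 _ _).trans (S.mem x)
  have h2 : form (g (S.σ x)) p₀.1 = 0 := by
    rw [← hgN, hg.1]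
    have := S.normal_tangent_AdS x
    simp only [form] at *; linarith
  have hmap := S.map_tangentPlane x hg.1 hgN
  rcases lt_or_gt_of_ne (form_timeField_ne_zero hp h1 h2) with h | h
  · exact ⟨_, ⟨h1, h2, h⟩, g, hg, hmap, rfl⟩
  · refine ⟨-g (S.σ x), ⟨?_, ?_, ?_⟩, _, hg.neg, S.map_neg_tangentPlane x hmap, by simp⟩
    all_goals simp only [form, Pi.neg_apply] at *; linarith

/-- The map `Φ_l` from the surface to the plane dual to `p₀`: the image of the point `x` under the
isometry that maps the tangent plane at `x` to the plane dual to `p₀` by following the left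
ruling. -/
def leftMap (S : SpacelikeSurface M) (p₀ : AdSHat) (x : M) : plane p₀ :=
  ⟨(S.exists_left p₀ x).choose, (S.exists_left p₀ x).choose_spec.1⟩

/-- The map `Φ_r`, defined in the same way by following the right ruling. -/
def rightMap (S : SpacelikeSurface M) (p₀ : AdSHat) (x : M) : plane p₀ :=
  ⟨(S.exists_right p₀ x).choose, (S.exists_right p₀ x).choose_spec.1⟩

end SpacelikeSurface

/-! ### Quasiconformal distortion -/

/-- The supremum norm `‖λ‖_∞` over the surface, an element of `[0,∞]`. -/
def supNorm {M : Type*} (lam : M → ℝ) : ℝ≥0∞ := ⨆ x, ENNReal.ofReal |lam x|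

/-- Unit tangent vectors at `y` of the plane dual to `p₀`. -/
def unitTangent (p₀ y : R22) : Set R22 := {v | form v y = 0 ∧ form v p₀ = 0 ∧ form v v = 1}

/-- The map `Φ` of the plane dual to `p₀`, extended arbitrarily to the vector space `ℝ^{2,2}`;
only its values on the plane matter. -/
def extendPlane {p₀ : AdSHat} (Φ : plane p₀ → plane p₀) : R22 → R22 :=
  Function.extend Subtype.val (fun y => (Φ y : R22)) 0

/-- `Φ` is differentiable at `y` as a map of the plane dual to `p₀`. -/
def DiffAt {p₀ : AdSHat} (Φ : plane p₀ → plane p₀) (y : plane p₀) : Prop :=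
  DifferentiableWithinAt ℝ (extendPlane Φ) (plane p₀) y

/-- The norm of `d_yΦ(v)`, for `v` tangent at `y` to the plane dual to `p₀`. -/
def stretch {p₀ : AdSHat} (Φ : plane p₀ → plane p₀) (y : plane p₀) (v : R22) : ℝ≥0∞ :=
  ENNReal.ofReal (√(form (fderivWithin ℝ (extendPlane Φ) (plane p₀) y v)
    (fderivWithin ℝ (extendPlane Φ) (plane p₀) y v)))

/-- The quasiconformal distortion of `Φ` at `y`, for `Φ` differentiable at `y`: the ratio of the
axes of the ellipse which is the image of the unit circle under the differential. -/
def distortion {p₀ : AdSHat} (Φ : plane p₀ → plane p₀) (y : plane p₀) : ℝ≥0∞ :=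
  (⨆ v ∈ unitTangent p₀ y, stretch Φ y v) / (⨅ v ∈ unitTangent p₀ y, stretch Φ y v)

/-- The maximal dilatation of `Φ`. -/
def maxDilatation {p₀ : AdSHat} (Φ : plane p₀ → plane p₀) : ℝ≥0∞ := ⨆ y, distortion Φ y

end AdSMaximal

end

open AdSMaximal

/-! Under the identification of `ℝ^{2,2}` with 2×2 matrices the form is `-det`, so `AdSHat` is
`SL₂(ℝ)`. A line of the left ruling consists of the singular matrices with a given kernel, so an
isometry following that ruling is a left multiplication (`FollowsLeft.eq_qmul`); transposition gives
right multiplications for the other ruling. The isometry taking the tangent plane `N^⊥` to `p₀^⊥`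
takes `N` to `±p₀`. Hence, for a future-directed normal, `Φ_l = p₀N⁻¹σ` and `Φ_r = σN⁻¹p₀`
(`leftMap_eq`, `rightMap_eq`). Up to the fixed factor `p₀` both take values in the hyperboloid `Hyp`
of traceless matrices of determinant one.

Let `J` be right multiplication by `N⁻¹σ`, a rotation by a right angle on each tangent plane.
Differentiation gives `d(N⁻¹σ) = N⁻¹(dσ - J dN)` and `d(σN⁻¹) = (dσ + J dN)N⁻¹` (`leftDiff_eq`,
`rightDiff_eq`). In an orthonormal eigenframe `e`, `f = Je` of the traceless shape operator, with
eigenvalues `λ` and `-λ`, these differentials scale the diagonals `e + f` and `e - f` by `|1 - λ|`,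
`|1 + λ|` on the left and by `|1 + λ|`, `|1 - λ|` on the right (`PointData.exists_frame`,
`PointData.bounds`). If `|λ| < 1`, then `Φ_l` is a local diffeomorphism and the singular values of
`dΦ` are `(1+|λ|)/(1-|λ|)` and its inverse, whose ratio is the distortion. The maximal dilatation
follows because `t ↦ ((1+t)/(1-t))²` is monotone and continuous on `[0,1]` with values in `[0,∞]`.

Bijectivity is a Hadamard argument that does not pass through completeness of the induced metric. An
entire surface is closed in `ℝ^{2,2}` (`IsEntire.isClosedEmbedding`). If `|λ| ≤ k < 1`, the
differential of `σ` along the inverse of `N⁻¹σ` (or `σN⁻¹`) is bounded by `‖σ‖` times a continuous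
function of the target point. By Grönwall a lift of a segment stays in a bounded, hence compact,
part of the surface, so segments lift (`HasGrowth.exists_lift`) and the map is bijective
(`HasGrowth.bijective`). -/

namespace AdSMaximal

/-! ### Global inversion of local homeomorphisms by lifting segments. -/

section PathLifting

open Set Filter Topology Metric

variable {X V F : Type*} [TopologicalSpace X] [NormedAddCommGroup V] [NormedSpace ℝ V]
  [NormedAddCommGroup F] [NormedSpace ℝ F]

/-- Over a compact set, a local homeomorphism to a metric space has local sections on balls of a
uniform radius. -/
theorem exists_uniform_section {V : Type*} [PseudoMetricSpace V] {f : X → V}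
    (hf : IsLocalHomeomorph f) {Z : Set X} (hZ : IsCompact Z) :
    ∃ δ > 0, ∀ x ∈ Z, ∃ g : V → X, ContinuousOn g (ball (f x) δ) ∧ g (f x) = x ∧
      ∀ y ∈ ball (f x) δ, f (g y) = y := by
  refine hZ.induction_on (p := fun Z => ∃ δ > 0, ∀ x ∈ Z, ∃ g : V → X,
    ContinuousOn g (ball (f x) δ) ∧ g (f x) = x ∧ ∀ y ∈ ball (f x) δ, f (g y) = y) ?_ ?_ ?_ ?_
  · exact ⟨1, one_pos, by simp⟩
  · rintro s t hst ⟨δ, hδ, h⟩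
    exact ⟨δ, hδ, fun x hx => h x (hst hx)⟩
  · rintro s t ⟨δ, hδ, h⟩ ⟨δ', hδ', h'⟩
    refine ⟨min δ δ', lt_min hδ hδ', ?_⟩
    rintro x (hx | hx)
    · obtain ⟨g, h1, h2, h3⟩ := h x hx
      exact ⟨g, h1.mono (ball_subset_ball (min_le_left _ _)), h2,
        fun y hy => h3 y (ball_subset_ball (min_le_left _ _) hy)⟩
    · obtain ⟨g, h1, h2, h3⟩ := h' x hx
      exact ⟨g, h1.mono (ball_subset_ball (min_le_right _ _)), h2,
        fun y hy => h3 y (ball_subset_ball (min_le_right _ _) hy)⟩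
  · intro x _
    obtain ⟨e, hxe, rfl⟩ := hf x
    obtain ⟨ε, hε, hball⟩ := Metric.isOpen_iff.1 e.open_target _ (e.map_source hxe)
    -- Half the radius: for `e z` within `ε / 2` of `e x`, the ball of radius `ε / 2` about `e z`
    -- still lies in the target, so the one inverse `e.symm` serves every nearby `z`.
    refine ⟨e.source ∩ e ⁻¹' ball (e x) (ε / 2), mem_nhdsWithin_of_mem_nhds
      (inter_mem (e.open_source.mem_nhds hxe)
        ((e.continuousAt hxe).preimage_mem_nhds (ball_mem_nhds _ (half_pos hε)))),
      ε / 2, half_pos hε, ?_⟩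
    rintro z ⟨hz, hz'⟩
    have hsub : ball (e z) (ε / 2) ⊆ e.target := fun y hy => hball <| by
      have h1 : dist y (e z) < ε / 2 := hy
      have h2 : dist (e z) (e x) < ε / 2 := hz'
      have := dist_triangle y (e z) (e x)
      rw [mem_ball]; linarith
    exact ⟨e.symm, e.continuousOn_symm.mono hsub, e.left_inv hz, fun y hy => e.right_inv (hsub hy)⟩

/-- The growth condition `‖d(σ ∘ f⁻¹)‖ ≤ K(f) ‖σ‖` for a local homeomorphism `f`. -/
def HasGrowth (f : X → V) (σ : X → F) (K : V → ℝ) : Prop :=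
  ∀ x, ∃ e : OpenPartialHomeomorph X V, x ∈ e.source ∧ EqOn f e e.source ∧
    ∃ D : V →L[ℝ] F, HasFDerivAt (σ ∘ e.symm) D (f x) ∧ ‖D‖ ≤ K (f x) * ‖σ x‖

theorem HasGrowth.isLocalHomeomorph {f : X → V} {σ : X → F} {K : V → ℝ} (h : HasGrowth f σ K) :
    IsLocalHomeomorph f :=
  IsLocalHomeomorph.mk f fun x => let ⟨e, hx, he, _⟩ := h x; ⟨e, hx, he⟩

/-- A priori bound for lifts of segments. -/
theorem HasGrowth.norm_lift_le {f : X → V} {σ : X → F} {K : V → ℝ} (h : HasGrowth f σ K)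
    (hσ : Continuous σ) {y v : V} {t C : ℝ}
    (hC : ∀ s ∈ Icc (0 : ℝ) t, K (y + s • v) * ‖v‖ ≤ C) {γ : ℝ → X}
    (hγ : ContinuousOn γ (Icc 0 t)) (hf : ∀ s ∈ Icc (0 : ℝ) t, f (γ s) = y + s • v) :
    ∀ s ∈ Icc (0 : ℝ) t, ‖σ (γ s)‖ ≤ ‖σ (γ 0)‖ * Real.exp (C * s) := by
  choose e hxe heq D hD hDK using h
  have key := norm_le_gronwallBound_of_norm_deriv_right_le (f := σ ∘ γ)
    (f' := fun s => D (γ s) v) (δ := ‖σ (γ 0)‖) (K := C) (ε := 0) (a := 0) (b := t)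
    (hσ.comp_continuousOn hγ) ?_ le_rfl ?_
  · intro s hs
    have := key s hs
    rwa [gronwallBound_ε0, sub_zero] at this
  · intro s hs
    have hs' : s ∈ Icc 0 t := Ico_subset_Icc_self hs
    have hc : HasDerivWithinAt (fun r : ℝ => y + r • v) v (Ici s) s := by
      have := ((hasDerivAt_id s).smul_const v).const_add y
      simpa using this.hasDerivWithinAt
    have hd : HasFDerivAt (σ ∘ (e (γ s)).symm) (D (γ s)) (y + s • v) := by
      rw [← hf s hs']; exact hD (γ s)
    -- By continuity `γ` stays in the source of the chart at `γ s` for a while, so there it is the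
    -- local inverse applied to the segment; this gives `σ ∘ γ` its right derivative.
    refine (hd.comp_hasDerivWithinAt s hc).congr_of_eventuallyEq ?_ ?_
    · have hmem : ∀ᶠ r in 𝓝[Ici s] s, r ∈ Icc 0 t := by
        filter_upwards [self_mem_nhdsWithin, mem_nhdsWithin_of_mem_nhds (Iio_mem_nhds hs.2)]
          with r h1 h2
        exact ⟨hs.1.trans h1, le_of_lt h2⟩
      have hcont : Tendsto γ (𝓝[Ici s] s) (𝓝 (γ s)) :=
        (hγ s hs').mono_left (le_inf inf_le_left (le_principal_iff.2 hmem))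
      filter_upwards [hmem, hcont ((e (γ s)).open_source.mem_nhds (hxe (γ s)))] with r h1 h2
      have h2 : γ r ∈ (e (γ s)).source := h2
      simp only [Function.comp_apply]
      rw [← hf r h1, heq _ h2, (e (γ s)).left_inv h2]
    · simp only [Function.comp_apply]
      rw [← hf s hs', heq _ (hxe _), (e (γ s)).left_inv (hxe _)]
  · intro s hs
    have hs' : s ∈ Icc 0 t := Ico_subset_Icc_self hs
    calc ‖D (γ s) v‖ ≤ ‖D (γ s)‖ * ‖v‖ := (D (γ s)).le_opNorm v
      _ ≤ K (f (γ s)) * ‖σ (γ s)‖ * ‖v‖ := by gcongr; exact hDK _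
      _ = (K (y + s • v) * ‖v‖) * ‖σ (γ s)‖ := by rw [hf s hs']; ring
      _ ≤ C * ‖σ (γ s)‖ := by gcongr; exact hC s hs'
      _ = C * ‖(σ ∘ γ) s‖ + 0 := by simp

/-- Segments can be lifted. -/
theorem HasGrowth.exists_lift [ProperSpace F] {f : X → V} {σ : X → F} {K : V → ℝ}
    (h : HasGrowth f σ K) (hσ : IsClosedEmbedding σ) (hK : Continuous K) (x : X) (v : V) :
    ∃ γ : ℝ → X, ContinuousOn γ (Icc 0 1) ∧ γ 0 = x ∧
      ∀ s ∈ Icc (0 : ℝ) 1, f (γ s) = f x + s • v := by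
  obtain ⟨C, hC⟩ : ∃ C, ∀ s ∈ Icc (0 : ℝ) 1, K (f x + s • v) * ‖v‖ ≤ C := by
    obtain ⟨C, hC⟩ := (isCompact_Icc (a := (0 : ℝ)) (b := 1)).bddAbove_image
      (f := fun s => K (f x + s • v) * ‖v‖) (by fun_prop)
    exact ⟨C, fun s hs => hC (mem_image_of_mem _ hs)⟩
  -- The Grönwall bound over all of `[0,1]`. It does not depend on how far the lift has been
  -- constructed, so one compact set and one radius `δ` serve all extensions.
  set R : ℝ := ‖σ x‖ * Real.exp |C| with hR
  obtain ⟨δ, hδ, hsec⟩ := exists_uniform_section h.isLocalHomeomorph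
    (hσ.isCompact_preimage (isCompact_closedBall (0 : F) R))
  set P : ℝ → Prop := fun t => ∃ γ : ℝ → X, ContinuousOn γ (Icc 0 t) ∧ γ 0 = x ∧
      ∀ s ∈ Icc (0 : ℝ) t, f (γ s) = f x + s • v with hP
  -- A time step during which the segment moves by less than `δ`; the `+ 1` covers `v = 0`.
  set η : ℝ := δ / (‖v‖ + 1) with hη
  have hvpos : 0 < ‖v‖ + 1 := by positivity
  have hη0 : 0 < η := by positivity
  have step : ∀ t t', 0 ≤ t → t ≤ t' → t' ≤ 1 → t' - t ≤ η → P t → P t' := by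
    rintro t t' h0 htt' h1 hle ⟨γ, hγ, hγ0, hγf⟩
    have hbound : ‖σ (γ t)‖ ≤ R := by
      refine (h.norm_lift_le hσ.continuous (C := C) (fun s hs => hC s ⟨hs.1, hs.2.trans
        (htt'.trans h1)⟩) hγ hγf t ⟨h0, le_rfl⟩).trans ?_
      rw [hR, hγ0]
      gcongr
      calc C * t ≤ |C| * t := by gcongr; exact le_abs_self C
        _ ≤ |C| * 1 := by gcongr; exact htt'.trans h1
        _ = |C| := mul_one _
    obtain ⟨g, g1, g2, g3⟩ := hsec (γ t) (by simpa using hbound)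
    have hmaps : MapsTo (fun s : ℝ => f x + s • v) (Icc t t') (ball (f (γ t)) δ) := by
      intro s hs
      rw [hγf t ⟨h0, le_rfl⟩, mem_ball, dist_eq_norm]
      calc ‖f x + s • v - (f x + t • v)‖ = ‖(s - t) • v‖ := by congr 1; module
        _ = (s - t) * ‖v‖ := by rw [norm_smul, Real.norm_of_nonneg (by linarith [hs.1])]
        _ ≤ η * ‖v‖ := by gcongr; linarith [hs.2]
        _ < η * (‖v‖ + 1) := by gcongr; linarith
        _ = δ := by rw [hη]; field_simp
    have hc2 : ContinuousOn (fun s : ℝ => g (f x + s • v)) (Icc t t') :=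
      g1.comp (by fun_prop) hmaps
    have hgt : g (f x + t • v) = γ t := by rw [← hγf t ⟨h0, le_rfl⟩, g2]
    set γ' : ℝ → X := fun s => if s ≤ t then γ s else g (f x + s • v) with hγ'
    have e1 : EqOn γ' γ (Icc 0 t) := fun s hs => if_pos hs.2
    have e2 : EqOn γ' (fun s : ℝ => g (f x + s • v)) (Icc t t') := fun s hs => by
      rcases hs.1.eq_or_lt with rfl | hlt
      · simp only [hγ', le_refl, if_true]; exact hgt.symm
      · exact if_neg (not_le.2 hlt)
    have hun : Icc 0 t ∪ Icc t t' = Icc 0 t' := Icc_union_Icc_eq_Icc h0 htt'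
    refine ⟨γ', ?_, ?_, ?_⟩
    · rw [← hun]
      exact (hγ.congr e1).union_of_isClosed (hc2.congr e2) isClosed_Icc isClosed_Icc
    · rw [e1 ⟨le_rfl, h0⟩, hγ0]
    · intro s hs
      rw [← hun] at hs
      rcases hs with hs | hs
      · rw [e1 hs, hγf s hs]
      · rw [e2 hs]; exact g3 _ (hmaps hs)
  have hP0 : P 0 := ⟨fun _ => x, continuousOn_const, rfl, fun s hs => by
    have : s = 0 := le_antisymm hs.2 hs.1
    simp [this]⟩
  have hall : ∀ n : ℕ, P (min (n * η) 1) := by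
    intro n
    induction n with
    | zero => simpa using hP0
    | succ n ih =>
      refine step _ _ (by positivity) ?_ (min_le_right _ _) ?_ ih
      · gcongr; simp
      · push_cast
        rcases le_total ((n : ℝ) * η) 1 with h1 | h1
        · rw [min_eq_left h1]; linarith [min_le_left (((n : ℝ) + 1) * η) 1]
        · rw [min_eq_right h1]; linarith [min_le_right (((n : ℝ) + 1) * η) 1]
  obtain ⟨n, hn⟩ := exists_nat_gt (1 / η)
  have := hall n
  rwa [min_eq_right] at this
  rw [div_lt_iff₀ hη0] at hn
  exact hn.le

/-- A global inversion theorem of Hadamard type. -/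
theorem HasGrowth.bijective [T2Space X] [ConnectedSpace X] [ProperSpace F] {f : X → V}
    {σ : X → F} {K : V → ℝ} (h : HasGrowth f σ K) (hσ : IsClosedEmbedding σ) (hK : Continuous K) :
    Function.Bijective f := by
  obtain ⟨x₀⟩ := (inferInstance : Nonempty X)
  choose γ hγc hγ0 hγf using fun y : V => h.exists_lift hσ hK x₀ (y - f x₀)
  have hl := h.isLocalHomeomorph
  have hsep : IsSeparatedMap f := T2Space.isSeparatedMap f
  have hcont : Continuous (fun p : unitInterval × V => γ p.2 p.1) := by
    refine hl.continuous_lift hsep (f := ⟨fun p : unitInterval × V => f x₀ + (p.1 : ℝ) • (p.2 - f x₀),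
      by fun_prop⟩) ?_ ?_ ?_
    · ext p
      exact hγf p.2 p.1 p.1.2
    · simpa [hγ0] using continuous_const
    · intro y
      exact continuousOn_iff_continuous_domRestrict.1 (hγc y)
  set s : V → X := fun y => γ y 1 with hs
  have hsc : Continuous s := hcont.comp (f := fun y : V => ((1 : unitInterval), y)) (by fun_prop)
  have hfs : ∀ y, f (s y) = y := fun y => by
    rw [hs, hγf y 1 ⟨zero_le_one, le_rfl⟩]; simp
  refine ⟨?_, fun y => ⟨s y, hfs y⟩⟩
  -- Injectivity: a continuous section of a local homeomorphism has open range, and the range is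
  -- also closed as the equalizer of `s ∘ f` and the identity. By connectedness `s` is onto, hence a
  -- two-sided inverse.
  have hopen : IsOpen (range s) := by
    have : IsLocalHomeomorph s := by
      refine IsLocalHomeomorph.of_comp (g := f) (f := s) ?_ hl hsc
      rw [show f ∘ s = id from funext hfs]
      exact (Homeomorph.refl V).isLocalHomeomorph
    exact this.isOpenMap.isOpen_range
  have hclosed : IsClosed (range s) := by
    have : range s = {x | s (f x) = x} := by
      ext x
      exact ⟨by rintro ⟨y, rfl⟩; simp [hfs], fun hx => ⟨f x, hx⟩⟩
    rw [this]
    exact isClosed_eq (hsc.comp hl.continuous) continuous_id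
  have huniv : range s = univ := IsClopen.eq_univ ⟨hclosed, hopen⟩ (range_nonempty s)
  intro a b hab
  obtain ⟨y, rfl⟩ : a ∈ range s := huniv ▸ mem_univ a
  obtain ⟨z, rfl⟩ : b ∈ range s := huniv ▸ mem_univ b
  rw [hfs, hfs] at hab
  rw [hab]

end PathLifting

/-! ### Multiplication of 2×2 matrices in coordinates -/

/-- The product of 2×2 matrices, transported to `ℝ^{2,2}`. -/
def qmul (x y : R22) : R22 :=
  ![x 2 * y 0 + x 0 * y 2 - x 1 * y 3 + x 3 * y 1,
    x 2 * y 1 + x 1 * y 2 + x 0 * y 3 - x 3 * y 0,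
    x 2 * y 2 + x 0 * y 0 + x 1 * y 1 - x 3 * y 3,
    x 2 * y 3 + x 3 * y 2 + x 0 * y 1 - x 1 * y 0]

/-- The adjugate of 2×2 matrices, transported to `ℝ^{2,2}`. -/
def qconj (x : R22) : R22 := ![-x 0, -x 1, x 2, -x 3]

/-- The identity matrix, in `ℝ^{2,2}`. -/
def qone : R22 := ![0, 0, 1, 0]

theorem toMat_qmul (x y : R22) : toMat (qmul x y) = toMat x * toMat y := by
  ext i j
  fin_cases i <;> fin_cases j <;> simp [toMat, qmul, Matrix.mul_apply, Fin.sum_univ_two] <;> ring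

theorem qmul_assoc (x y z : R22) : qmul (qmul x y) z = qmul x (qmul y z) :=
  toMat.injective (by simp only [toMat_qmul, Matrix.mul_assoc])

theorem ext4 {x y : R22} (h0 : x 0 = y 0) (h1 : x 1 = y 1) (h2 : x 2 = y 2) (h3 : x 3 = y 3) :
    x = y := by
  ext i; fin_cases i <;> assumption

theorem qmul_qconj (x : R22) : qmul x (qconj x) = (-form x x) • qone := by
  apply ext4 <;> simp [qmul, qconj, qone, form] <;> ring

theorem qconj_qmul (x : R22) : qmul (qconj x) x = (-form x x) • qone := by
  apply ext4 <;> simp [qmul, qconj, qone, form] <;> ring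

theorem qone_qmul (x : R22) : qmul qone x = x := by
  apply ext4 <;> simp [qmul, qone]

theorem qmul_qone (x : R22) : qmul x qone = x := by
  apply ext4 <;> simp [qmul, qone]

theorem qmul_smul_left (c : ℝ) (x y : R22) : qmul (c • x) y = c • qmul x y := by
  apply ext4 <;> simp [qmul] <;> ring

theorem qmul_smul_right (c : ℝ) (x y : R22) : qmul x (c • y) = c • qmul x y := by
  apply ext4 <;> simp [qmul] <;> ring

theorem qconj_qmul_cancel {p : R22} (hp : form p p = -1) (x : R22) :
    qmul (qconj p) (qmul p x) = x := by
  rw [← qmul_assoc, qconj_qmul, hp, neg_neg, one_smul, qone_qmul]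

theorem qmul_qconj_cancel {p : R22} (hp : form p p = -1) (x : R22) :
    qmul p (qmul (qconj p) x) = x := by
  rw [← qmul_assoc, qmul_qconj, hp, neg_neg, one_smul, qone_qmul]

theorem qmul_qconj_cancel_right {p : R22} (hp : form p p = -1) (x : R22) :
    qmul (qmul x p) (qconj p) = x := by
  rw [qmul_assoc, qmul_qconj, hp, neg_neg, one_smul, qmul_qone]

theorem qconj_qmul_cancel_right {p : R22} (hp : form p p = -1) (x : R22) :
    qmul (qmul x (qconj p)) p = x := by
  rw [qmul_assoc, qconj_qmul, hp, neg_neg, one_smul, qmul_qone]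

theorem form_comm (x y : R22) : form x y = form y x := by
  simp only [form]; ring

theorem form_qconj (x : R22) : form (qconj x) (qconj x) = form x x := by
  simp [form, qconj]

theorem form_qmul_left (p x y : R22) : form (qmul p x) (qmul p y) = -form p p * form x y := by
  simp [form, qmul]; ring

theorem form_qmul_right (p x y : R22) : form (qmul x p) (qmul y p) = -form p p * form x y := by
  simp [form, qmul]; ring

/-- Matrix multiplication as a continuous bilinear map. -/
noncomputable def qmulL : R22 →L[ℝ] R22 →L[ℝ] R22 :=
  LinearMap.toContinuousBilinearMap (LinearMap.mk₂ ℝ qmul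
    (fun a b c => by apply ext4 <;> simp [qmul] <;> ring)
    (fun c a b => qmul_smul_left c a b)
    (fun a b c => by apply ext4 <;> simp [qmul] <;> ring)
    (fun c a b => qmul_smul_right c a b))

@[simp] theorem qmulL_apply (x y : R22) : qmulL x y = qmul x y := rfl

/-- The adjugate as a continuous linear map. -/
noncomputable def qconjL : R22 →L[ℝ] R22 :=
  LinearMap.toContinuousLinearMap
    { toFun := qconj
      map_add' := fun a b => by apply ext4 <;> simp [qconj] <;> ring
      map_smul' := fun c a => by apply ext4 <;> simp [qconj] }

@[simp] theorem qconjL_apply (x : R22) : qconjL x = qconj x := rfl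

/-- The form as a continuous bilinear map. -/
noncomputable def formL : R22 →L[ℝ] R22 →L[ℝ] ℝ :=
  LinearMap.toContinuousBilinearMap (LinearMap.mk₂ ℝ form
    (fun a b c => by simp [form]; ring)
    (fun c a b => by simp [form]; ring)
    (fun a b c => by simp [form]; ring)
    (fun c a b => by simp [form]; ring))

@[simp] theorem formL_apply (x y : R22) : formL x y = form x y := rfl

/-! ### The hyperbolic plane -/

/-- The hyperboloid model of the hyperbolic plane in the space of traceless matrices. -/
def Hyp : Set R22 := {h | form h h = -1 ∧ h 2 = 0 ∧ 0 < h 3}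

/-- The coordinates on the hyperbolic plane. -/
noncomputable def coordL : R22 →L[ℝ] E2 :=
  LinearMap.toContinuousLinearMap
    { toFun := fun x => !₂[x 0, x 1]
      map_add' := fun a b => by ext i; fin_cases i <;> simp
      map_smul' := fun c a => by ext i; fin_cases i <;> simp }

@[simp] theorem coordL_zero (x : R22) : coordL x 0 = x 0 := rfl
@[simp] theorem coordL_one (x : R22) : coordL x 1 = x 1 := rfl

theorem coordL_eq_iff {x y : R22} : coordL x = coordL y ↔ x 0 = y 0 ∧ x 1 = y 1 := by
  refine ⟨fun h => ⟨congrArg (fun z : E2 => z 0) h, congrArg (fun z : E2 => z 1) h⟩, fun h => ?_⟩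
  ext i; fin_cases i
  · exact h.1
  · exact h.2

theorem Hyp.sq {h : R22} (hh : h ∈ Hyp) : h 3 ^ 2 = 1 + h 0 ^ 2 + h 1 ^ 2 := by
  obtain ⟨h1, h2, -⟩ := hh
  simp only [form, h2] at h1
  linarith

theorem coordL_injOn : Set.InjOn coordL Hyp := by
  intro x hx y hy h
  obtain ⟨h0, h1⟩ := coordL_eq_iff.1 h
  refine ext4 h0 h1 (hx.2.1.trans hy.2.1.symm) ?_
  have h3 : x 3 ^ 2 = y 3 ^ 2 := by rw [Hyp.sq hx, Hyp.sq hy, h0, h1]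
  nlinarith [hx.2.2, hy.2.2]

/-- Tangent vectors of the hyperbolic plane are determined by their coordinates. -/
theorem tangent_ext {h v w : R22} (hh : h ∈ Hyp) (hv : form v h = 0) (hv2 : v 2 = 0)
    (hw : form w h = 0) (hw2 : w 2 = 0) (hvw : coordL v = coordL w) : v = w := by
  obtain ⟨h0, h1⟩ := coordL_eq_iff.1 hvw
  refine ext4 h0 h1 (hv2.trans hw2.symm) ?_
  have h3 := hh.2.2
  simp only [form, hv2, hw2, h0, h1] at hv hw
  have : (v 3 - w 3) * h 3 = 0 := by linarith
  rcases mul_eq_zero.1 this with h | h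
  · linarith
  · exact absurd h h3.ne'

/-- Cauchy–Schwarz in the first two coordinates. The sign of this product is the test for lying on
the same sheet of the hyperboloid. -/
theorem form_neg_of_mem_Hyp {h k : R22} (hh : h ∈ Hyp) (hk : k ∈ Hyp) : form h k < 0 := by
  have h1 := Hyp.sq hh
  have h2 := Hyp.sq hk
  have : (h 0 * k 0 + h 1 * k 1) ^ 2 < (h 3 * k 3) ^ 2 := by
    rw [mul_pow, h1, h2]
    nlinarith [sq_nonneg (h 0 * k 1 - h 1 * k 0), sq_nonneg (h 0), sq_nonneg (h 1),
      sq_nonneg (k 0), sq_nonneg (k 1)]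
  have h3 := abs_lt_of_sq_lt_sq this (mul_pos hh.2.2 hk.2.2).le
  have h4 := le_abs_self (h 0 * k 0 + h 1 * k 1)
  simp only [form, hh.2.1]
  linarith

/-- Rotation by a right angle, in coordinates. -/
def qrot : R22 := ![0, 0, 0, 1]

theorem qrot_mem_Hyp : qrot ∈ Hyp := by
  simp [Hyp, qrot, form]

/-- Conjugation preserves determinant and trace; only the sheet is in question. The last coordinate
is minus the product with `qrot`, and by invariance of the form this product equals that of `h` with
the conjugate of `qrot` by the inverse, for which the sheet is visible from an explicit sum of
squares. -/
theorem conj_mem_Hyp {p h : R22} (hp : form p p = -1) (hh : h ∈ Hyp) :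
    qmul (qmul p h) (qconj p) ∈ Hyp := by
  have key : ∀ q : R22, form q q = -1 → qmul (qmul q qrot) (qconj q) ∈ Hyp := by
    intro q hq
    refine ⟨?_, ?_, ?_⟩
    · rw [form_qmul_right, form_qconj, hq, form_qmul_left, hq]
      simp [form, qrot]
    · simp [qmul, qrot, qconj]; ring
    · simp only [form] at hq
      simp [qmul, qrot, qconj]
      nlinarith [sq_nonneg (q 0), sq_nonneg (q 1), sq_nonneg (q 2), sq_nonneg (q 3)]
  have hc : form (qconj p) (qconj p) = -1 := by rw [form_qconj, hp]
  refine ⟨?_, ?_, ?_⟩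
  · rw [form_qmul_right, form_qconj, hp, form_qmul_left, hp, hh.1]; norm_num
  · have := hh.2.1
    simp [qmul, qconj]
    linear_combination (p 2 ^ 2 + p 3 ^ 2 - p 0 ^ 2 - p 1 ^ 2) * this
  · have h1 := form_neg_of_mem_Hyp hh (key _ hc)
    have h2 : form (qmul (qmul p h) (qconj p)) qrot =
        form h (qmul (qmul (qconj p) qrot) (qconj (qconj p))) := by
      simp [form, qmul, qconj, qrot]; ring
    rw [← h2] at h1
    simp [form, qrot] at h1
    simpa using h1

/-- The time field at `p` is half of `p · qrot + qrot · p`. So twice the product of `ph` with it is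
the sum of the products of `h` and of `php⁻¹` with `qrot`, both negative. -/
theorem qmul_mem_plane_left {p h : R22} (hp : form p p = -1) (hh : h ∈ Hyp) :
    qmul p h ∈ plane p := by
  refine ⟨by rw [form_qmul_left, hp, hh.1]; norm_num, ?_, ?_⟩
  · have := hh.2.1
    simp only [form] at hp ⊢
    simp [qmul]
    linear_combination (-p 2 ^ 2 - p 3 ^ 2 + p 0 ^ 2 + p 1 ^ 2) * this
  · have h1 := form_neg_of_mem_Hyp hh qrot_mem_Hyp
    have h2 := form_neg_of_mem_Hyp (conj_mem_Hyp hp hh) qrot_mem_Hyp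
    have h3 : 2 * form (qmul p h) (timeField p) =
        -form p p * form h qrot + form (qmul (qmul p h) (qconj p)) qrot := by
      simp [form, qmul, qconj, qrot, timeField]; ring
    rw [hp] at h3
    linarith

theorem qmul_mem_plane_right {p h : R22} (hp : form p p = -1) (hh : h ∈ Hyp) :
    qmul h p ∈ plane p := by
  have h1 : qmul (qmul (qconj p) h) (qconj (qconj p)) ∈ Hyp :=
    conj_mem_Hyp (by rw [form_qconj, hp]) hh
  have h2 := qmul_mem_plane_left hp h1
  rwa [qmul_assoc, qmul_qconj_cancel hp, show qconj (qconj p) = p by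
    apply ext4 <;> simp [qconj]] at h2

theorem qmul_neg (x y : R22) : qmul x (-y) = -qmul x y := by
  apply ext4 <;> simp [qmul] <;> ring

theorem neg_qmul (x y : R22) : qmul (-x) y = -qmul x y := by
  apply ext4 <;> simp [qmul] <;> ring

theorem mem_Hyp_or_neg {h : R22} (h1 : form h h = -1) (h2 : h 2 = 0) : h ∈ Hyp ∨ -h ∈ Hyp := by
  have h3 : h 3 ≠ 0 := by
    intro h3
    simp only [form, h2, h3] at h1
    nlinarith [sq_nonneg (h 0), sq_nonneg (h 1)]
  rcases lt_or_gt_of_ne h3 with h | h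
  · exact Or.inr ⟨by simpa [form] using h1, by simp [h2], by simpa using h⟩
  · exact Or.inl ⟨h1, h2, h⟩

theorem neg_notMem_plane {p y : R22} (hy : y ∈ plane p) : -y ∉ plane p := by
  intro h
  have h1 := hy.2.2
  have h2 := h.2.2
  simp only [form, Pi.neg_apply] at h1 h2
  linarith

/-- If `p⁻¹y` were on the opposite sheet, then `-y` would be in the plane together with `y`, and
their time orientations differ. -/
theorem qconj_mem_of_plane {p y : R22} (hp : form p p = -1) (hy : y ∈ plane p) :
    qmul (qconj p) y ∈ Hyp := by
  have h1 : form (qmul (qconj p) y) (qmul (qconj p) y) = -1 := by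
    rw [form_qmul_left, form_qconj, hp, hy.1]; norm_num
  have h2 : qmul (qconj p) y 2 = 0 := by
    have := hy.2.1
    simp only [form] at this
    simp [qmul, qconj]
    linarith
  rcases mem_Hyp_or_neg h1 h2 with h | h
  · exact h
  · have := qmul_mem_plane_left hp h
    rw [qmul_neg, qmul_qconj_cancel hp] at this
    exact absurd this (neg_notMem_plane hy)

theorem mem_qconj_of_plane {p y : R22} (hp : form p p = -1) (hy : y ∈ plane p) :
    qmul y (qconj p) ∈ Hyp := by
  have := conj_mem_Hyp hp (qconj_mem_of_plane hp hy)
  rwa [qmul_qconj_cancel hp] at this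

/-! ### Isometries following a ruling -/

theorem sameLeftLine_iff {ξ η : R22} : SameLeftLine ξ η ↔ ∃ a b : ℝ, (a ≠ 0 ∨ b ≠ 0) ∧
    ((ξ 2 + ξ 0) * a + (ξ 1 + ξ 3) * b = 0 ∧ (ξ 1 - ξ 3) * a + (ξ 2 - ξ 0) * b = 0) ∧
    (η 2 + η 0) * a + (η 1 + η 3) * b = 0 ∧ (η 1 - η 3) * a + (η 2 - η 0) * b = 0 := by
  have key : ∀ (ζ : R22) (k : Fin 2 → ℝ), (toMat ζ).mulVec k = 0 ↔
      (ζ 2 + ζ 0) * k 0 + (ζ 1 + ζ 3) * k 1 = 0 ∧ (ζ 1 - ζ 3) * k 0 + (ζ 2 - ζ 0) * k 1 = 0 := by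
    intro ζ k
    simp [funext_iff, toMat, dotProduct, Fin.forall_fin_two]
  constructor
  · rintro ⟨k, hk, h1, h2⟩
    refine ⟨k 0, k 1, ?_, (key _ _).1 h1, (key _ _).1 h2⟩
    by_contra! h
    exact hk (by ext i; fin_cases i <;> simp [h])
  · rintro ⟨a, b, hab, h1, h2⟩
    refine ⟨![a, b], ?_, (key _ _).2 (by simpa using h1), (key _ _).2 (by simpa using h2)⟩
    intro h
    simp at h
    tauto

theorem sameRightLine_iff {ξ η : R22} : SameRightLine ξ η ↔ ∃ a b : ℝ, (a ≠ 0 ∨ b ≠ 0) ∧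
    ((ξ 2 + ξ 0) * a + (ξ 1 - ξ 3) * b = 0 ∧ (ξ 1 + ξ 3) * a + (ξ 2 - ξ 0) * b = 0) ∧
    (η 2 + η 0) * a + (η 1 - η 3) * b = 0 ∧ (η 1 + η 3) * a + (η 2 - η 0) * b = 0 := by
  have key : ∀ (ζ : R22) (k : Fin 2 → ℝ), Matrix.vecMul k (toMat ζ) = 0 ↔
      (ζ 2 + ζ 0) * k 0 + (ζ 1 - ζ 3) * k 1 = 0 ∧ (ζ 1 + ζ 3) * k 0 + (ζ 2 - ζ 0) * k 1 = 0 := by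
    intro ζ k
    simp [funext_iff, toMat, Matrix.vecHead, Matrix.vecTail, Fin.forall_fin_two, mul_comm]
  constructor
  · rintro ⟨k, hk, h1, h2⟩
    refine ⟨k 0, k 1, ?_, (key _ _).1 h1, (key _ _).1 h2⟩
    by_contra! h
    exact hk (by ext i; fin_cases i <;> simp [h])
  · rintro ⟨a, b, hab, h1, h2⟩
    refine ⟨![a, b], ?_, (key _ _).2 (by simpa using h1), (key _ _).2 (by simpa using h2)⟩
    intro h
    simp at h
    tauto

theorem eq_sum_null (x : R22) : x = ((x 2 + x 0) / 2) • (![1, 0, 1, 0] : R22) +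
    ((x 1 + x 3) / 2) • (![0, 1, 0, 1] : R22) + ((x 1 - x 3) / 2) • (![0, 1, 0, -1] : R22) +
    ((x 2 - x 0) / 2) • (![-1, 0, 1, 0] : R22) := by
  apply ext4 <;> simp <;> ring

theorem qone_eq : qone = (1 / 2 : ℝ) • (![1, 0, 1, 0] : R22) +
    (1 / 2 : ℝ) • (![-1, 0, 1, 0] : R22) := by
  ext i
  fin_cases i <;> simp [qone]
  norm_num

/-- A nonzero singular 2×2 matrix has a one-dimensional kernel, which `g` must preserve. So `g`
preserves the matrices with zero second column (`col1`), with zero first column (`col2`) and with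
equal columns (`diag`). The first two say that `g` acts on each column separately, the third that it
acts on both by the same linear map; this map is the matrix `g qone`. -/
theorem FollowsLeft.eq_qmul {g : R22 ≃ₗ[ℝ] R22} (hg : FollowsLeft g) (x : R22) :
    g x = qmul (g qone) x := by
  have hL := fun ξ hξ => sameLeftLine_iff.1 (hg.2 ξ hξ)
  have col1 : ∀ ξ : R22, ξ 1 + ξ 3 = 0 → ξ 2 - ξ 0 = 0 → (ξ 2 + ξ 0 ≠ 0 ∨ ξ 1 - ξ 3 ≠ 0) →
      g ξ 1 + g ξ 3 = 0 ∧ g ξ 2 - g ξ 0 = 0 := by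
    intro ξ h1 h2 h3
    obtain ⟨a, b, hab, ⟨e1, e2⟩, e3, e4⟩ := hL ξ (by
      simp only [form]; linear_combination (ξ 1 - ξ 3) * h1 - (ξ 0 + ξ 2) * h2)
    rw [h1, zero_mul, add_zero] at e1
    rw [h2, zero_mul, add_zero] at e2
    have ha : a = 0 := by
      rcases h3 with h3 | h3
      · exact (mul_eq_zero.1 e1).resolve_left h3
      · exact (mul_eq_zero.1 e2).resolve_left h3
    have hb : b ≠ 0 := hab.resolve_left (by simp [ha])
    simp only [ha, mul_zero, zero_add, mul_eq_zero, hb, or_false] at e3 e4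
    exact ⟨e3, e4⟩
  have col2 : ∀ ξ : R22, ξ 2 + ξ 0 = 0 → ξ 1 - ξ 3 = 0 → (ξ 1 + ξ 3 ≠ 0 ∨ ξ 2 - ξ 0 ≠ 0) →
      g ξ 2 + g ξ 0 = 0 ∧ g ξ 1 - g ξ 3 = 0 := by
    intro ξ h1 h2 h3
    obtain ⟨a, b, hab, ⟨e1, e2⟩, e3, e4⟩ := hL ξ (by
      simp only [form]; linear_combination (ξ 0 - ξ 2) * h1 + (ξ 1 + ξ 3) * h2)
    rw [h1, zero_mul, zero_add] at e1
    rw [h2, zero_mul, zero_add] at e2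
    have hb : b = 0 := by
      rcases h3 with h3 | h3
      · exact (mul_eq_zero.1 e1).resolve_left h3
      · exact (mul_eq_zero.1 e2).resolve_left h3
    have ha : a ≠ 0 := hab.resolve_right (by simp [hb])
    simp only [hb, mul_zero, add_zero, mul_eq_zero, ha, or_false] at e3 e4
    exact ⟨e3, e4⟩
  have diag : ∀ ξ : R22, ξ 2 + ξ 0 = ξ 1 + ξ 3 → ξ 1 - ξ 3 = ξ 2 - ξ 0 →
      (ξ 1 + ξ 3 ≠ 0 ∨ ξ 2 - ξ 0 ≠ 0) →
      g ξ 2 + g ξ 0 = g ξ 1 + g ξ 3 ∧ g ξ 1 - g ξ 3 = g ξ 2 - g ξ 0 := by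
    intro ξ h1 h2 h3
    obtain ⟨a, b, hab, ⟨e1, e2⟩, e3, e4⟩ := hL ξ (by
      simp only [form]; linear_combination (ξ 0 - ξ 2) * h1 + (ξ 1 + ξ 3) * h2)
    rw [h1, ← mul_add] at e1
    rw [h2, ← mul_add] at e2
    have hb : a + b = 0 := by
      rcases h3 with h3 | h3
      · exact (mul_eq_zero.1 e1).resolve_left h3
      · exact (mul_eq_zero.1 e2).resolve_left h3
    obtain rfl : b = -a := by linarith
    have ha : a ≠ 0 := by simpa using hab
    constructor <;> apply mul_right_cancel₀ ha <;> linarith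
  obtain ⟨a1, a2⟩ := col1 ![1, 0, 1, 0] (by simp) (by simp) (by simp)
  obtain ⟨b1, b2⟩ := col1 ![0, 1, 0, -1] (by simp) (by simp) (by simp)
  obtain ⟨c1, c2⟩ := col2 ![0, 1, 0, 1] (by simp) (by simp) (by simp)
  obtain ⟨d1, d2⟩ := col2 ![-1, 0, 1, 0] (by simp) (by simp) (by simp)
  obtain ⟨f1, f2⟩ := diag (![1, 0, 1, 0] + ![0, 1, 0, 1]) (by simp) (by simp) (by simp)
  obtain ⟨k1, k2⟩ := diag (![0, 1, 0, -1] + ![-1, 0, 1, 0]) (by simp) (by simp) (by simp)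
  simp only [map_add, Pi.add_apply] at f1 f2 k1 k2
  have hx := congrArg g (eq_sum_null x)
  simp only [map_add, map_smul] at hx
  rw [hx, qone_eq, map_add, map_smul, map_smul]
  generalize g ![1, 0, 1, 0] = u at *
  generalize g ![0, 1, 0, -1] = v at *
  generalize g ![0, 1, 0, 1] = w at *
  generalize g ![-1, 0, 1, 0] = z at *
  have u0 : u 0 = u 2 := by linarith
  have u1 : u 1 = -u 3 := by linarith
  have v0 : v 0 = v 2 := by linarith
  have v1 : v 1 = -v 3 := by linarith
  have w0 : w 0 = u 3 := by linarith
  have w1 : w 1 = u 2 := by linarith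
  have w2 : w 2 = -u 3 := by linarith
  have w3 : w 3 = u 2 := by linarith
  have z0 : z 0 = v 3 := by linarith
  have z1 : z 1 = v 2 := by linarith
  have z2 : z 2 = -v 3 := by linarith
  have z3 : z 3 = v 2 := by linarith
  apply ext4 <;>
    simp only [qmul, Pi.add_apply, Pi.smul_apply, smul_eq_mul, Matrix.cons_val, u0, u1, v0, v1,
      w0, w1, w2, w3, z0, z1, z2, z3] <;> ring

/-- Transposition of matrices; it exchanges the two rulings. -/
def transp : R22 ≃ₗ[ℝ] R22 where
  toFun x := ![x 0, x 1, x 2, -x 3]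
  map_add' x y := by apply ext4 <;> simp; ring
  map_smul' c x := by apply ext4 <;> simp
  invFun x := ![x 0, x 1, x 2, -x 3]
  left_inv x := by apply ext4 <;> simp
  right_inv x := by apply ext4 <;> simp

theorem transp_qmul (x y : R22) : transp (qmul x y) = qmul (transp y) (transp x) := by
  apply ext4 <;> simp [transp, qmul] <;> ring

theorem transp_transp (x : R22) : transp (transp x) = x := transp.left_inv x

theorem form_transp (x y : R22) : form (transp x) (transp y) = form x y := by
  simp [form, transp]

/-- Conjugation by transposition reduces this to the left ruling and reverses products. -/
theorem FollowsRight.eq_qmul {g : R22 ≃ₗ[ℝ] R22} (hg : FollowsRight g) (x : R22) :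
    g x = qmul x (g qone) := by
  have h : FollowsLeft (transp ≪≫ₗ g ≪≫ₗ transp) := by
    refine ⟨fun x y => ?_, fun ξ hξ => ?_⟩
    · simp only [LinearEquiv.trans_apply]
      rw [form_transp, hg.1, form_transp]
    · have := sameRightLine_iff.1 (hg.2 (transp ξ) (by rw [form_transp, hξ]))
      rw [sameLeftLine_iff]
      simpa [transp, sub_eq_add_neg] using this
  have := congrArg transp (h.eq_qmul (transp x))
  have h1 : transp qone = qone := by apply ext4 <;> simp [transp, qone]
  simp only [LinearEquiv.trans_apply, transp_qmul, transp_transp, h1] at this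
  exact this

theorem eq_zero_of_form {x : R22} (h : ∀ z, form x z = 0) : x = 0 := by
  have h0 := h (Pi.single 0 1)
  have h1 := h (Pi.single 1 1)
  have h2 := h (Pi.single 2 1)
  have h3 := h (Pi.single 3 1)
  simp [form] at h0 h1 h2 h3
  exact ext4 h0 h1 h2 h3

namespace SpacelikeSurface

variable {M : Type*} [TopologicalSpace M] [ChartedSpace E2 M] [IsManifold 𝓘(ℝ, E2) ∞ M]

/-- An isometry mapping a tangent plane to another one maps unit normals to unit normals. -/
theorem map_normal (S : SpacelikeSurface M) (x : M) {p₀ : R22} (hp : form p₀ p₀ = -1)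
    {g : R22 ≃ₗ[ℝ] R22} (hg : IsIsometry g)
    (h : (S.tangentPlane x).map g.toLinearMap = perp p₀) : g (S.N x) = p₀ ∨ g (S.N x) = -p₀ := by
  rw [tangentPlane_eq] at h
  have h1 : ∀ w, form w p₀ = 0 → form (g (S.N x)) w = 0 := by
    intro w hw
    have : w ∈ perp p₀ := hw
    rw [← h] at this
    obtain ⟨u, hu, rfl⟩ := this
    have hu : form u (S.N x) = 0 := hu
    change form (g (S.N x)) (g u) = 0
    rw [hg, form_comm, hu]
  have h2 : g (S.N x) = (-form (g (S.N x)) p₀) • p₀ := by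
    rw [← sub_eq_zero]
    apply eq_zero_of_form
    intro z
    -- The orthogonal projection of `z` to `p₀^⊥`, with sign `+` because `p₀` has square `-1`.
    have := h1 (z + form z p₀ • p₀) (by
      have e : form (z + form z p₀ • p₀) p₀ = form z p₀ + form z p₀ * form p₀ p₀ := by
        simp only [form, Pi.add_apply, Pi.smul_apply, smul_eq_mul]; ring
      rw [e, hp]; ring)
    have e : form (g (S.N x)) (z + form z p₀ • p₀) =
        form (g (S.N x)) z + form z p₀ * form (g (S.N x)) p₀ := by
      simp only [form, Pi.add_apply, Pi.smul_apply, smul_eq_mul]; ring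
    rw [e] at this
    have e2 : form (g (S.N x) - (-form (g (S.N x)) p₀) • p₀) z =
        form (g (S.N x)) z + form (g (S.N x)) p₀ * form z p₀ := by
      simp only [form, Pi.sub_apply, Pi.smul_apply, smul_eq_mul]; ring
    rw [e2]; linarith
  set c := -form (g (S.N x)) p₀ with hc
  have h3 : form (g (S.N x)) (g (S.N x)) = -1 := by rw [hg, S.normal_unit]
  have h4 : form (g (S.N x)) (g (S.N x)) = c * c * form p₀ p₀ := by
    conv_lhs => rw [h2]
    simp only [form, Pi.smul_apply, smul_eq_mul]; ring
  rw [hp, h3] at h4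
  rcases mul_self_eq_one_iff.1 (show c * c = 1 by linarith) with h5 | h5
  · left; rw [h2, h5, one_smul]
  · right; rw [h2, h5, neg_one_smul]

/-- The normal field is future-directed along the surface. -/
def IsOriented (S : SpacelikeSurface M) : Prop :=
  ∀ x, qmul (qconj (S.N x)) (S.σ x) ∈ Hyp

theorem IsOriented.mem_right {S : SpacelikeSurface M} (h : S.IsOriented) (x : M) :
    qmul (S.σ x) (qconj (S.N x)) ∈ Hyp := by
  have := conj_mem_Hyp (S.normal_unit x) (h x)
  rwa [qmul_qconj_cancel (S.normal_unit x)] at this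

/-- Whichever isometry was chosen, it is left multiplication by `g(N)N⁻¹ = ±p₀N⁻¹`. The minus sign
is impossible, since the chosen value lies in the plane and `p₀N⁻¹σ` does too. -/
theorem IsOriented.leftMap_eq {S : SpacelikeSurface M} (h : S.IsOriented) (p₀ : AdSHat) (x : M) :
    (S.leftMap p₀ x : R22) = qmul p₀ (qmul (qconj (S.N x)) (S.σ x)) := by
  obtain ⟨g, hg, hm, hy⟩ := (S.exists_left p₀ x).choose_spec.2
  have hmem := (S.leftMap p₀ x).2
  have hy : g (S.σ x) = (S.leftMap p₀ x : R22) := hy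
  rw [← hy] at hmem ⊢
  have hpl := qmul_mem_plane_left p₀.2 (h x)
  have hN := hg.eq_qmul (S.N x)
  have ha : g qone = qmul (g (S.N x)) (qconj (S.N x)) := by
    rw [hN, qmul_qconj_cancel_right (S.normal_unit x)]
  rw [hg.eq_qmul, ha, qmul_assoc] at hmem ⊢
  rcases S.map_normal x p₀.2 hg.1 hm with h1 | h1
  · rw [h1]
  · rw [h1, neg_qmul] at hmem
    exact absurd hmem (neg_notMem_plane hpl)

theorem IsOriented.rightMap_eq {S : SpacelikeSurface M} (h : S.IsOriented) (p₀ : AdSHat) (x : M) :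
    (S.rightMap p₀ x : R22) = qmul (qmul (S.σ x) (qconj (S.N x))) p₀ := by
  obtain ⟨g, hg, hm, hy⟩ := (S.exists_right p₀ x).choose_spec.2
  have hmem := (S.rightMap p₀ x).2
  have hy : g (S.σ x) = (S.rightMap p₀ x : R22) := hy
  rw [← hy] at hmem ⊢
  have hpl := qmul_mem_plane_right p₀.2 (h.mem_right x)
  have hN := hg.eq_qmul (S.N x)
  have ha : g qone = qmul (qconj (S.N x)) (g (S.N x)) := by
    rw [hN, qconj_qmul_cancel (S.normal_unit x)]
  rw [hg.eq_qmul, ha, ← qmul_assoc] at hmem ⊢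
  rcases S.map_normal x p₀.2 hg.1 hm with h1 | h1
  · rw [h1]
  · rw [h1, qmul_neg] at hmem
    exact absurd hmem (neg_notMem_plane hpl)

end SpacelikeSurface

/-! ### The differentials of the left and right maps at a point -/

theorem form_add_left (x y z : R22) : form (x + y) z = form x z + form y z := by
  simp only [form, Pi.add_apply]; ring

theorem form_add_right (x y z : R22) : form x (y + z) = form x y + form x z := by
  simp only [form, Pi.add_apply]; ring

theorem form_smul_left (c : ℝ) (x y : R22) : form (c • x) y = c * form x y := by
  simp only [form, Pi.smul_apply, smul_eq_mul]; ring

theorem form_smul_right (c : ℝ) (x y : R22) : form x (c • y) = c * form x y := by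
  simp only [form, Pi.smul_apply, smul_eq_mul]; ring

theorem qmul_add (x y z : R22) : qmul x (y + z) = qmul x y + qmul x z := by
  apply ext4 <;> simp [qmul] <;> ring

theorem add_qmul (x y z : R22) : qmul (x + y) z = qmul x z + qmul y z := by
  apply ext4 <;> simp [qmul] <;> ring

theorem qconj_qmul_comm {x y : R22} (h : form x y = 0) : qmul (qconj x) y = -qmul (qconj y) x := by
  have : qmul (qconj x) y + qmul (qconj y) x = (-(2 * form x y)) • qone := by
    apply ext4 <;> simp [qmul, qconj, form, qone] <;> ring
  rw [h] at this
  simp at this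
  exact eq_neg_of_add_eq_zero_left this

theorem qmul_qconj_comm {x y : R22} (h : form x y = 0) : qmul x (qconj y) = -qmul y (qconj x) := by
  have : qmul x (qconj y) + qmul y (qconj x) = (-(2 * form x y)) • qone := by
    apply ext4 <;> simp [qmul, qconj, form, qone] <;> ring
  rw [h] at this
  simp at this
  exact eq_neg_of_add_eq_zero_left this

/-- The differential of `N⁻¹σ`, for tangent vectors `a` and `b` to `σ = s` and `N = n`. -/
def leftDiff (s n a b : R22) : R22 := qmul (qconj n) a + qmul (qconj b) s

/-- The differential of `σN⁻¹`, for tangent vectors `a` and `b` to `σ = s` and `N = n`. -/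
def rightDiff (s n a b : R22) : R22 := qmul a (qconj n) + qmul s (qconj b)

/-- The complex structure on the tangent plane. -/
def rot (s n a : R22) : R22 := qmul a (qmul (qconj n) s)


theorem qmul_sq {s n : R22} (hs : form s s = -1) (hn : form n n = -1) (hns : form n s = 0) :
    qmul (qmul (qconj n) s) (qmul (qconj n) s) = -qone := by
  nth_rewrite 1 [qconj_qmul_comm hns]
  rw [neg_qmul, qmul_assoc, qmul_qconj_cancel hn, qconj_qmul, hs]
  simp

theorem rot_rot {s n : R22} (hs : form s s = -1) (hn : form n n = -1) (hns : form n s = 0)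
    (a : R22) : rot s n (rot s n a) = -a := by
  rw [rot, rot, qmul_assoc, qmul_sq hs hn hns, qmul_neg, qmul_qone]

theorem form_rot_rot {s n : R22} (hs : form s s = -1) (hn : form n n = -1) (a b : R22) :
    form (rot s n a) (rot s n b) = form a b := by
  rw [rot, rot, form_qmul_right, form_qmul_left, form_qconj, hs, hn]; ring

theorem form_rot_self {s n : R22} (hns : form n s = 0) (a : R22) :
    form a (rot s n a) = 0 := by
  have : form a (rot s n a) = -form a a * form n s := by
    simp [rot, form, qmul, qconj]; ring
  rw [this, hns, mul_zero]

/-- With `J² = -1`, the isometry `J` permutes `n` and `s` up to sign, and so preserves their common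
orthogonal complement, the tangent plane. -/
theorem rot_n {s n : R22} (hn : form n n = -1) : rot s n n = s := by
  rw [rot, qmul_qconj_cancel hn]

theorem form_rot_s {s n a : R22} (hs : form s s = -1) (hn : form n n = -1)
    (han : form a n = 0) : form (rot s n a) s = 0 := by
  have := form_rot_rot hs hn a n
  rwa [rot_n hn, han] at this

theorem form_rot_n {s n a : R22} (hs : form s s = -1) (hn : form n n = -1) (hns : form n s = 0)
    (has : form a s = 0) : form (rot s n a) n = 0 := by
  have h1 := form_rot_rot hs hn a s
  have h2 : rot s n s = -n := by 
    rw [← rot_rot hs hn hns n, rot_n hn]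
  rw [h2, has] at h1
  have : form (rot s n a) (-n) = -form (rot s n a) n := by
    simp only [form, Pi.neg_apply]; ring
  linarith

/-- The rule `d(n⁻¹) = -n⁻¹(dn)n⁻¹`; since `b ⊥ n`, it is the identity `qconj b = -n⁻¹bn⁻¹`. -/
theorem leftDiff_eq {s n a b : R22} (hn : form n n = -1) (hbn : form b n = 0) :
    leftDiff s n a b = qmul (qconj n) (a + -rot s n b) := by
  have h : qconj b = -qmul (qmul (qconj n) b) (qconj n) := by
    have := qconj_qmul_comm hbn
    rw [← neg_qmul, ← neg_eq_iff_eq_neg.2 this, neg_neg, qmul_qconj_cancel_right hn]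
  rw [leftDiff, qmul_add, qmul_neg, rot, h, neg_qmul]
  simp only [qmul_assoc]

/-- Orthogonality is used twice, each time with a change of sign: to move the adjugate from `b` to
`s`, and to write `s⁻¹ = -n⁻¹sn⁻¹`. Hence `+J` here against `-J` for the left map. -/
theorem rightDiff_eq {s n a b : R22} (hn : form n n = -1)
    (hns : form n s = 0) (hbs : form b s = 0) :
    rightDiff s n a b = qmul (a + rot s n b) (qconj n) := by
  rw [rightDiff, add_qmul, rot, qmul_qconj_comm (x := s) (by rw [form_comm, hbs])]
  have h1 : qconj s = -qmul (qmul (qconj n) s) (qconj n) := by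
    have := qconj_qmul_comm (x := s) (by rw [form_comm, hns])
    rw [← neg_qmul, ← neg_eq_iff_eq_neg.2 this, neg_neg, qmul_qconj_cancel_right hn]
  rw [h1, qmul_neg, neg_neg, ← qmul_assoc]

theorem form_leftDiff {s n a b : R22} (hn : form n n = -1) (hbn : form b n = 0) :
    form (leftDiff s n a b) (leftDiff s n a b) =
      form (a + -rot s n b) (a + -rot s n b) := by
  rw [leftDiff_eq hn hbn, form_qmul_left, form_qconj, hn]; ring

theorem form_rightDiff {s n a b : R22} (hn : form n n = -1)
    (hns : form n s = 0) (hbs : form b s = 0) :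
    form (rightDiff s n a b) (rightDiff s n a b) =
      form (a + rot s n b) (a + rot s n b) := by
  rw [rightDiff_eq hn hns hbs, form_qmul_right, form_qconj, hn]; ring

/-- The first order data of a spacelike surface at a point: the point `s`, the normal `n`, their
differentials `A` and `B`, and the shape operator `W`. -/
structure PointData (s n : R22) (A B : E2 →ₗ[ℝ] R22) (W : Module.End ℝ E2) : Prop where
  hs : form s s = -1
  hn : form n n = -1
  hns : form n s = 0
  As : ∀ v, form (A v) s = 0
  An : ∀ v, form (A v) n = 0
  Bs : ∀ v, form (B v) s = 0
  Bn : ∀ v, form (B v) n = 0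
  symm : ∀ v w, form (B v) (A w) = form (B w) (A v)
  pos : ∀ v, v ≠ 0 → 0 < form (A v) (A v)
  range : ∀ w, form w s = 0 → form w n = 0 → ∃ v, A v = w
  AW : ∀ v, A (W v) = B v
  trace : LinearMap.trace ℝ E2 W = 0

theorem PointData.nonneg {s n : R22} {A B : E2 →ₗ[ℝ] R22} {W : Module.End ℝ E2}
    (h : PointData s n A B W) (v : E2) : 0 ≤ form (A v) (A v) := by
  by_cases hv : v = 0
  · rw [hv, map_zero]; simp [form]
  · exact (h.pos v hv).le

/-- Diagonalization of the shape operator. -/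
theorem PointData.exists_frame {s n : R22} {A B : E2 →ₗ[ℝ] R22} {W : Module.End ℝ E2}
    (h : PointData s n A B W) {l : ℝ} (hl : W.HasEigenvalue l) :
    ∃ e f : E2, (∀ v, ∃ a b : ℝ, v = a • e + b • f) ∧ ∀ a b : ℝ,
      form (A (a • e + b • f)) (A (a • e + b • f)) = a ^ 2 + b ^ 2 ∧
      form (leftDiff s n (A (a • e + b • f)) (B (a • e + b • f)))
        (leftDiff s n (A (a • e + b • f)) (B (a • e + b • f))) =
        (a - l * b) ^ 2 + (b - l * a) ^ 2 ∧
      form (rightDiff s n (A (a • e + b • f)) (B (a • e + b • f)))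
        (rightDiff s n (A (a • e + b • f)) (B (a • e + b • f))) =
        (a + l * b) ^ 2 + (b + l * a) ^ 2 := by
  obtain ⟨e', he'⟩ := hl.exists_hasEigenvector
  have hpos := h.pos e' he'.2
  set c := √(form (A e') (A e')) with hc
  have hcc : c * c = form (A e') (A e') := Real.mul_self_sqrt hpos.le
  have hc0 : c ≠ 0 := by positivity
  obtain ⟨e, he⟩ : ∃ e : E2, e = c⁻¹ • e' := ⟨_, rfl⟩
  have hAe : form (A e) (A e) = 1 := by
    rw [he, map_smul, form_smul_left, form_smul_right, ← hcc]; field_simp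
  have hWe : W e = l • e := by rw [he, map_smul, he'.apply_eq_smul, smul_comm]
  -- The second frame vector is `f = Je`, automatically orthonormal to `e`, so that `J` has its
  -- standard matrix.
  obtain ⟨f, hf⟩ := h.range (rot s n (A e)) (form_rot_s h.hs h.hn (h.An e))
    (form_rot_n h.hs h.hn h.hns (h.As e))
  have hef : form (A e) (A f) = 0 := by rw [hf, form_rot_self h.hns]
  have hff : form (A f) (A f) = 1 := by rw [hf, form_rot_rot h.hs h.hn, hAe]
  have hfe : form (A f) (A e) = 0 := by rw [form_comm, hef]
  have hli : LinearIndependent ℝ ![e, f] := by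
    rw [LinearIndependent.pair_iff]
    intro a b hab
    have h0 := congrArg A hab
    rw [map_add, map_smul, map_smul, map_zero] at h0
    constructor
    · have := congrArg (form (A e)) h0
      rw [form_add_right, form_smul_right, form_smul_right, hAe, hef] at this
      simpa [form] using this
    · have := congrArg (form (A f)) h0
      rw [form_add_right, form_smul_right, form_smul_right, hfe, hff] at this
      simpa [form] using this
  set b := basisOfLinearIndependentOfCardEqFinrank hli (by simp) with hb
  have hb0 : b 0 = e := by simp [hb]
  have hb1 : b 1 = f := by simp [hb]
  have hspan : ∀ v, v = b.repr v 0 • e + b.repr v 1 • f := fun v => by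
    have := b.sum_repr v
    rw [Fin.sum_univ_two, hb0, hb1] at this
    exact this.symm
  -- Self-adjointness removes the `e`-component, and the vanishing trace gives the `f`-component.
  have hWf : W f = -l • f := by
    have h1 := hspan (W f)
    have h2 : b.repr (W f) 0 = 0 := by
      have h3 := h.symm f e
      rw [← h.AW, ← h.AW, h1, hWe] at h3
      simp only [map_add, map_smul, form_add_left, form_smul_left, hAe, hfe, hef] at h3
      linarith
    have h4 : LinearMap.trace ℝ E2 W = b.repr (W e) 0 + b.repr (W f) 1 := by
      rw [LinearMap.trace_eq_matrix_trace ℝ b, Matrix.trace_fin_two, LinearMap.toMatrix_apply,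
        LinearMap.toMatrix_apply, hb0, hb1]
    rw [h.trace, hWe, map_smul, ← hb0, b.repr_self] at h4
    have h5 : b.repr (W f) 1 = -l := by
      simp at h4
      linarith
    rw [h1, h2, h5, zero_smul, zero_add]
  have hBe : B e = l • A e := by rw [← h.AW, hWe, map_smul]
  have hBf : B f = -l • A f := by rw [← h.AW, hWf, map_smul]
  have hrot : ∀ p q : ℝ, rot s n (p • A e + q • A f) = p • A f + -q • A e := by
    intro p q
    rw [rot, add_qmul, qmul_smul_left, qmul_smul_left, ← rot, ← rot, ← hf, hf,
      rot_rot h.hs h.hn h.hns]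
    simp
  refine ⟨e, f, fun v => ⟨_, _, hspan v⟩, fun p q => ⟨?_, ?_, ?_⟩⟩
  · simp only [map_add, map_smul, form_add_left, form_smul_left, form_add_right,
      form_smul_right, hAe, hfe, hef, hff]
    ring
  · rw [form_leftDiff h.hn (h.Bn _)]
    rw [show B (p • e + q • f) = (l * p) • A e + (-l * q) • A f by
      rw [map_add, map_smul, map_smul, hBe, hBf]; module, hrot]
    rw [show A (p • e + q • f) + -((l * p) • A f + -(-l * q) • A e) =
      (p - l * q) • A e + (q - l * p) • A f by rw [map_add, map_smul, map_smul]; module]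
    simp only [form_add_left, form_smul_left, form_add_right,
      form_smul_right, hAe, hfe, hef, hff]
    ring
  · rw [form_rightDiff h.hn h.hns (h.Bs _)]
    rw [show B (p • e + q • f) = (l * p) • A e + (-l * q) • A f by
      rw [map_add, map_smul, map_smul, hBe, hBf]; module, hrot]
    rw [show A (p • e + q • f) + ((l * p) • A f + -(-l * q) • A e) =
      (p + l * q) • A e + (q + l * p) • A f by rw [map_add, map_smul, map_smul]; module]
    simp only [form_add_left, form_smul_left, form_add_right,
      form_smul_right, hAe, hfe, hef, hff]
    ring

section PointData

variable {s n : R22} {A B : E2 →ₗ[ℝ] R22} {W : Module.End ℝ E2}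

/-- In the eigenframe the two squared lengths are `(1 + l²)(a² + b²) ∓ 4lab`, and everything follows
from `2|lab| ≤ |l|(a² + b²)`, with equality on the diagonals `a = ±b`. The comparison of right with
left is multiplied out so as to make sense without `|l| < 1`. -/
theorem PointData.bounds (h : PointData s n A B W) {l : ℝ} (hl : W.HasEigenvalue l) :
    (∀ v, (1 - |l|) ^ 2 * form (A v) (A v) ≤
      form (leftDiff s n (A v) (B v)) (leftDiff s n (A v) (B v))) ∧
    (∀ v, (1 - |l|) ^ 2 * form (A v) (A v) ≤
      form (rightDiff s n (A v) (B v)) (rightDiff s n (A v) (B v))) ∧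
    (∀ v, (1 - |l|) ^ 2 * form (rightDiff s n (A v) (B v)) (rightDiff s n (A v) (B v)) ≤
      (1 + |l|) ^ 2 * form (leftDiff s n (A v) (B v)) (leftDiff s n (A v) (B v))) ∧
    (∀ v, (1 - |l|) ^ 2 * form (leftDiff s n (A v) (B v)) (leftDiff s n (A v) (B v)) ≤
      (1 + |l|) ^ 2 * form (rightDiff s n (A v) (B v)) (rightDiff s n (A v) (B v))) ∧
    (∃ v ≠ 0, (1 - |l|) ^ 2 * form (rightDiff s n (A v) (B v)) (rightDiff s n (A v) (B v)) =
      (1 + |l|) ^ 2 * form (leftDiff s n (A v) (B v)) (leftDiff s n (A v) (B v))) ∧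
    ∃ v ≠ 0, (1 - |l|) ^ 2 * form (leftDiff s n (A v) (B v)) (leftDiff s n (A v) (B v)) =
      (1 + |l|) ^ 2 * form (rightDiff s n (A v) (B v)) (rightDiff s n (A v) (B v)) := by
  obtain ⟨e, f, hspan, hq⟩ := h.exists_frame hl
  have hne : ∀ a b : ℝ, a ^ 2 + b ^ 2 ≠ 0 → a • e + b • f ≠ 0 := by
    intro a b hab h0
    apply hab
    rw [← (hq a b).1, h0, map_zero]
    simp [form]
  have h1 : l ≤ |l| := le_abs_self l
  have h2 : -l ≤ |l| := neg_le_abs l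
  have h3 : |l| ^ 2 = l ^ 2 := sq_abs l
  have h0 : 0 ≤ |l| := abs_nonneg l
  have ab1 : ∀ a b : ℝ, 2 * l * a * b ≤ |l| * (a ^ 2 + b ^ 2) := fun a b => by
    nlinarith [mul_nonneg (sub_nonneg.2 h1) (sq_nonneg (a + b)),
      mul_nonneg (sub_nonneg.2 h2) (sq_nonneg (a - b))]
  have ab2 : ∀ a b : ℝ, -(2 * l * a * b) ≤ |l| * (a ^ 2 + b ^ 2) := fun a b => by
    have := ab1 (-a) b
    nlinarith
  have e1 : ∀ a b : ℝ, (1 + |l|) ^ 2 * ((a - l * b) ^ 2 + (b - l * a) ^ 2) -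
      (1 - |l|) ^ 2 * ((a + l * b) ^ 2 + (b + l * a) ^ 2) =
      4 * (1 + l ^ 2) * (|l| * (a ^ 2 + b ^ 2) - 2 * l * a * b) := fun a b => by
    linear_combination (-8 * l * a * b) * h3
  have e2 : ∀ a b : ℝ, (1 + |l|) ^ 2 * ((a + l * b) ^ 2 + (b + l * a) ^ 2) -
      (1 - |l|) ^ 2 * ((a - l * b) ^ 2 + (b - l * a) ^ 2) =
      4 * (1 + l ^ 2) * (|l| * (a ^ 2 + b ^ 2) + 2 * l * a * b) := fun a b => by
    linear_combination (8 * l * a * b) * h3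
  -- `t` is a sign of `l`: the diagonal `e + tf` is shortest for the left map and longest for the
  -- right one, and `e - tf` the reverse.
  obtain ⟨t, ht, hlt⟩ : ∃ t : ℝ, t * t = 1 ∧ |l| = l * t := by
    rcases abs_choice l with h | h
    · exact ⟨1, by norm_num, by rw [h]; ring⟩
    · exact ⟨-1, by norm_num, by rw [h]; ring⟩
  refine ⟨fun v => ?_, fun v => ?_, fun v => ?_, fun v => ?_, ⟨(1 : ℝ) • e + t • f,
    hne _ _ (by positivity), ?_⟩, ⟨(1 : ℝ) • e + (-t) • f, hne _ _ (by positivity), ?_⟩⟩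
  · obtain ⟨a, b, rfl⟩ := hspan v
    rw [(hq a b).1, (hq a b).2.1]
    have := ab1 a b
    nlinarith
  · obtain ⟨a, b, rfl⟩ := hspan v
    rw [(hq a b).1, (hq a b).2.2]
    have := ab2 a b
    nlinarith
  · obtain ⟨a, b, rfl⟩ := hspan v
    rw [(hq a b).2.1, (hq a b).2.2, ← sub_nonneg, e1]
    exact mul_nonneg (by positivity) (sub_nonneg.2 (ab1 a b))
  · obtain ⟨a, b, rfl⟩ := hspan v
    rw [(hq a b).2.1, (hq a b).2.2, ← sub_nonneg, e2]
    exact mul_nonneg (by positivity) (by linarith [ab2 a b])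
  · rw [(hq _ _).2.1, (hq _ _).2.2, eq_comm, ← sub_eq_zero, e1, hlt]
    linear_combination (4 * (1 + l ^ 2) * l * t) * ht
  · rw [(hq _ _).2.1, (hq _ _).2.2, eq_comm, ← sub_eq_zero, e2, hlt]
    linear_combination (4 * (1 + l ^ 2) * l * t) * ht

theorem form_qone (x : R22) : form x qone = -x 2 := by
  simp [form, qone]

/-- Multiplication by `n⁻¹` is an isometry taking `n` to the identity and `s` to `n⁻¹s`, so it takes
vectors orthogonal to `n` and `s` to traceless ones orthogonal to `n⁻¹s`. -/
theorem PointData.leftDiff_tangent (h : PointData s n A B W) (v : E2) :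
    form (leftDiff s n (A v) (B v)) (qmul (qconj n) s) = 0 ∧ leftDiff s n (A v) (B v) 2 = 0 := by
  have key : ∀ w, form w s = 0 → form w n = 0 → form (qmul (qconj n) w) (qmul (qconj n) s) = 0 ∧
      qmul (qconj n) w 2 = 0 := by
    intro w h1 h2
    have hc : form (qconj n) (qconj n) = -1 := by rw [form_qconj, h.hn]
    refine ⟨by rw [form_qmul_left, hc, h1, mul_zero], ?_⟩
    have : form (qmul (qconj n) w) qone = 0 := by
      have := qconj_qmul n
      rw [h.hn, neg_neg, one_smul] at this
      rw [← this, form_qmul_left, hc, h2, mul_zero]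
    rw [form_qone] at this
    linarith
  rw [leftDiff_eq h.hn (h.Bn v)]
  have hneg : ∀ w z : R22, form (-w) z = -form w z := fun w z => by
    simp only [form, Pi.neg_apply]; ring
  apply key
  · rw [form_add_left, hneg, h.As, form_rot_s h.hs h.hn (h.Bn v)]; simp
  · rw [form_add_left, hneg, h.An, form_rot_n h.hs h.hn h.hns (h.Bs v)]; simp

theorem PointData.rightDiff_tangent (h : PointData s n A B W) (v : E2) :
    form (rightDiff s n (A v) (B v)) (qmul s (qconj n)) = 0 ∧
      rightDiff s n (A v) (B v) 2 = 0 := by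
  have key : ∀ w, form w s = 0 → form w n = 0 → form (qmul w (qconj n)) (qmul s (qconj n)) = 0 ∧
      qmul w (qconj n) 2 = 0 := by
    intro w h1 h2
    have hc : form (qconj n) (qconj n) = -1 := by rw [form_qconj, h.hn]
    refine ⟨by rw [form_qmul_right, hc, h1, mul_zero], ?_⟩
    have : form (qmul w (qconj n)) qone = 0 := by
      have := qmul_qconj n
      rw [h.hn, neg_neg, one_smul] at this
      rw [← this, form_qmul_right, hc, h2, mul_zero]
    rw [form_qone] at this
    linarith
  rw [rightDiff_eq h.hn h.hns (h.Bs v)]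
  apply key
  · rw [form_add_left, h.As, form_rot_s h.hs h.hn (h.Bn v)]; simp
  · rw [form_add_left, h.An, form_rot_n h.hs h.hn h.hns (h.Bs v)]; simp

/-! ### Growth estimates -/

theorem norm_qmul_le (x y : R22) : ‖qmul x y‖ ≤ 4 * ‖x‖ * ‖y‖ := by
  have hm : ∀ i j, |x i * y j| ≤ ‖x‖ * ‖y‖ := fun i j => by
    rw [abs_mul]
    exact mul_le_mul (norm_le_pi_norm x i) (norm_le_pi_norm y j) (abs_nonneg _) (norm_nonneg _)
  rw [pi_norm_le_iff_of_nonneg (by positivity)]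
  have h := fun i j => abs_le.1 (hm i j)
  intro i
  rw [Real.norm_eq_abs, abs_le]
  fin_cases i
  · simp [qmul]
    constructor <;> linarith [(h 2 0).1, (h 0 2).1, (h 1 3).1, (h 3 1).1, (h 2 0).2, (h 0 2).2,
      (h 1 3).2, (h 3 1).2]
  · simp [qmul]
    constructor <;> linarith [(h 2 1).1, (h 1 2).1, (h 0 3).1, (h 3 0).1, (h 2 1).2, (h 1 2).2,
      (h 0 3).2, (h 3 0).2]
  · simp [qmul]
    constructor <;> linarith [(h 2 2).1, (h 0 0).1, (h 1 1).1, (h 3 3).1, (h 2 2).2, (h 0 0).2,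
      (h 1 1).2, (h 3 3).2]
  · simp [qmul]
    constructor <;> linarith [(h 2 3).1, (h 3 2).1, (h 0 1).1, (h 1 0).1, (h 2 3).2, (h 3 2).2,
      (h 0 1).2, (h 1 0).2]

/-- A spacelike vector tangent to the hyperbolic plane is bounded in terms of its length. -/
theorem norm_tangent_le {X a : R22} (hX : X ∈ Hyp) (haX : form a X = 0) (ha2 : a 2 = 0) :
    ‖a‖ ≤ X 3 * √(form a a) := by
  have h3 := Hyp.sq hX
  have hp := hX.2.2
  simp only [form, ha2] at haX
  have e : a 3 * X 3 = a 0 * X 0 + a 1 * X 1 := by linarith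
  have h1 : X 3 ^ 2 * a 3 ^ 2 ≤ (a 0 ^ 2 + a 1 ^ 2) * (X 3 ^ 2 - 1) := by
    have : X 3 ^ 2 * a 3 ^ 2 = (a 0 * X 0 + a 1 * X 1) ^ 2 := by rw [← e]; ring
    rw [this, h3]
    nlinarith [sq_nonneg (a 0 * X 1 - a 1 * X 0)]
  have h2 : a 0 ^ 2 + a 1 ^ 2 ≤ X 3 ^ 2 * form a a := by
    simp only [form, ha2]; nlinarith
  have h4 : a 3 ^ 2 ≤ a 0 ^ 2 + a 1 ^ 2 := by
    have hx : 0 < X 3 ^ 2 := by positivity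
    by_contra! hlt
    nlinarith [mul_lt_mul_of_pos_left hlt hx, sq_nonneg (a 0), sq_nonneg (a 1)]
  have hq : 0 ≤ form a a := by
    have hx : 0 < X 3 ^ 2 := by positivity
    by_contra! hlt
    nlinarith [mul_neg_of_pos_of_neg hx hlt, sq_nonneg (a 0), sq_nonneg (a 1)]
  have key : ∀ i, a i ^ 2 ≤ (X 3 * √(form a a)) ^ 2 := by
    intro i
    rw [mul_pow, Real.sq_sqrt hq]
    fin_cases i
    · change a 0 ^ 2 ≤ _
      nlinarith [sq_nonneg (a 1)]
    · change a 1 ^ 2 ≤ _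
      nlinarith [sq_nonneg (a 0)]
    · change a 2 ^ 2 ≤ _
      rw [ha2]; nlinarith [sq_nonneg (a 0), sq_nonneg (a 1)]
    · exact h4.trans h2
  rw [pi_norm_le_iff_of_nonneg (by positivity)]
  exact fun i => abs_le_of_sq_le_sq (key i) (by positivity)

/-- Since `s · n⁻¹s = -n`, the vector `s⁻¹u` is tangent to the hyperbolic plane at `n⁻¹s`, where
`norm_tangent_le` applies; multiplying back by `s` costs `4‖s‖`. The remaining factor depends only
on the image point `n⁻¹s`, which makes the growth estimate usable along a lifted path. -/
theorem norm_le_left {u : R22} (hs : form s s = -1) (hns : form n s = 0)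
    (hX : qmul (qconj n) s ∈ Hyp) (hus : form u s = 0) (hun : form u n = 0) :
    ‖u‖ ≤ 4 * ‖s‖ * (qmul (qconj n) s 3 * √(form u u)) := by
  have hc : form (qconj s) (qconj s) = -1 := by rw [form_qconj, hs]
  have hsX : qmul s (qmul (qconj n) s) = -n := by
    rw [← qmul_assoc, qmul_qconj_comm (x := s) (by rw [form_comm, hns]), neg_qmul,
      qconj_qmul_cancel_right hs]
  have h1 : form (qmul (qconj s) u) (qmul (qconj n) s) = 0 := by
    have := form_qmul_left s (qmul (qconj s) u) (qmul (qconj n) s)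
    rw [qmul_qconj_cancel hs, hsX, hs] at this
    have h2 : form u (-n) = -form u n := by simp only [form, Pi.neg_apply]; ring
    rw [h2, hun] at this
    linarith
  have h2 : qmul (qconj s) u 2 = 0 := by
    have e : form (qmul (qconj s) u) qone = 0 := by
      have := qconj_qmul s
      rw [hs, neg_neg, one_smul] at this
      rw [← this, form_qmul_left, hc, hus, mul_zero]
    rw [form_qone] at e
    linarith
  have h3 := norm_tangent_le hX h1 h2
  rw [form_qmul_left, hc, neg_neg, one_mul] at h3
  calc ‖u‖ = ‖qmul s (qmul (qconj s) u)‖ := by rw [qmul_qconj_cancel hs]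
    _ ≤ 4 * ‖s‖ * ‖qmul (qconj s) u‖ := norm_qmul_le _ _
    _ ≤ _ := by gcongr

theorem norm_le_right {u : R22} (hs : form s s = -1) (hns : form n s = 0)
    (hX : qmul s (qconj n) ∈ Hyp) (hus : form u s = 0) (hun : form u n = 0) :
    ‖u‖ ≤ 4 * ‖s‖ * (qmul s (qconj n) 3 * √(form u u)) := by
  have hc : form (qconj s) (qconj s) = -1 := by rw [form_qconj, hs]
  have hsX : qmul (qmul s (qconj n)) s = -n := by
    rw [qmul_qconj_comm (x := s) (by rw [form_comm, hns]), neg_qmul,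
      qconj_qmul_cancel_right hs]
  have h1 : form (qmul u (qconj s)) (qmul s (qconj n)) = 0 := by
    have := form_qmul_right s (qmul u (qconj s)) (qmul s (qconj n))
    rw [qconj_qmul_cancel_right hs, hsX, hs] at this
    have h2 : form u (-n) = -form u n := by simp only [form, Pi.neg_apply]; ring
    rw [h2, hun] at this
    linarith
  have h2 : qmul u (qconj s) 2 = 0 := by
    have e : form (qmul u (qconj s)) qone = 0 := by
      have := qmul_qconj s
      rw [hs, neg_neg, one_smul] at this
      rw [← this, form_qmul_right, hc, hus, mul_zero]
    rw [form_qone] at e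
    linarith
  have h3 := norm_tangent_le hX h1 h2
  rw [form_qmul_right, hc, neg_neg, one_mul] at h3
  calc ‖u‖ = ‖qmul (qmul u (qconj s)) s‖ := by rw [qconj_qmul_cancel_right hs]
    _ ≤ 4 * ‖qmul u (qconj s)‖ * ‖s‖ := norm_qmul_le _ _
    _ ≤ 4 * (qmul s (qconj n) 3 * √(form u u)) * ‖s‖ := by gcongr
    _ = _ := by ring

end PointData

/-! ### Differentials in charts -/

section Charts

open Set Filter Topology

variable {M : Type*} [TopologicalSpace M] [ChartedSpace E2 M]
  {F : Type*} [NormedAddCommGroup F] [NormedSpace ℝ F]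

theorem contDiffAt_chart [IsManifold 𝓘(ℝ, E2) ∞ M] {h : M → F}
    (hh : ContMDiff 𝓘(ℝ, E2) 𝓘(ℝ, F) ∞ h) (x : M) :
    ContDiffAt ℝ ∞ (h ∘ (chartAt E2 x).symm) (chartAt E2 x x) := by
  have := (contMDiffAt_iff.1 (hh x)).2
  simpa [mfld_simps, contDiffWithinAt_univ, chartAt_self_eq] using this

theorem hasStrictFDerivAt_chart [IsManifold 𝓘(ℝ, E2) ∞ M] {h : M → F}
    (hh : ContMDiff 𝓘(ℝ, E2) 𝓘(ℝ, F) ∞ h) (x : M) :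
    HasStrictFDerivAt (h ∘ (chartAt E2 x).symm)
      (mfderiv 𝓘(ℝ, E2) 𝓘(ℝ, F) h x : E2 →L[ℝ] F) (chartAt E2 x x) := by
  have h1 := (contDiffAt_chart hh x).hasStrictFDerivAt (by simp)
  have h2 : mfderiv 𝓘(ℝ, E2) 𝓘(ℝ, F) h x =
      fderiv ℝ (h ∘ (chartAt E2 x).symm) (chartAt E2 x x) := by
    rw [(hh.mdifferentiable (by simp) x).mfderiv]
    simp [mfld_simps, writtenInExtChartAt, chartAt_self_eq]
    rfl
  rw [h2]
  exact h1

/-- At a point other than the centre of the chart the derivative in the chart need not agree with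
`mfderiv` vector by vector, but its values lie in the same range. This suffices to use orthogonality
of the normal at all nearby points. -/
theorem fderiv_chart_apply [IsManifold 𝓘(ℝ, E2) ∞ M] {h : M → F}
    (hh : ContMDiff 𝓘(ℝ, E2) 𝓘(ℝ, F) ∞ h) (x : M) {z : E2} (hz : z ∈ (chartAt E2 x).target)
    (w : E2) : ∃ v : TangentSpace 𝓘(ℝ, E2) ((chartAt E2 x).symm z),
      fderiv ℝ (h ∘ (chartAt E2 x).symm) z w =
        mfderiv 𝓘(ℝ, E2) 𝓘(ℝ, F) h ((chartAt E2 x).symm z) v := by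
  have : IsManifold 𝓘(ℝ, E2) 1 M := IsManifold.of_le (n := ∞) (by simp)
  have h1 : MDifferentiableAt 𝓘(ℝ, E2) 𝓘(ℝ, E2) (chartAt E2 x).symm z :=
    mdifferentiableAt_atlas_symm (chart_mem_atlas E2 x) hz
  have h2 := mfderiv_comp z (hh.mdifferentiable (by simp) _) h1
  rw [mfderiv_eq_fderiv] at h2
  exact ⟨mfderiv 𝓘(ℝ, E2) 𝓘(ℝ, E2) (chartAt E2 x).symm z w, by rw [h2]; rfl⟩

theorem hasStrictFDerivAt_bilinear (b : R22 →L[ℝ] R22 →L[ℝ] F) {f g : E2 → R22}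
    {f' g' : E2 →L[ℝ] R22} {z : E2} (hf : HasStrictFDerivAt f f' z)
    (hg : HasStrictFDerivAt g g' z) : ∃ D : E2 →L[ℝ] F,
      HasStrictFDerivAt (fun y => b (f y) (g y)) D z ∧
        ∀ v, D v = b (f z) (g' v) + b (f' v) (g z) :=
  ⟨_, b.hasStrictFDerivAt_of_bilinear hf hg, fun v => by simp⟩

/-- A function with injective differential at `x` is a homeomorphism near `x`; the composition of
another function with its inverse is differentiable. -/
theorem exists_local_inverse {f : M → E2} {x : M} {D : E2 →L[ℝ] E2}
    (hf : HasStrictFDerivAt (f ∘ (chartAt E2 x).symm) D (chartAt E2 x x))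
    (hD : Function.Injective D) :
    ∃ e : OpenPartialHomeomorph M E2, x ∈ e.source ∧ EqOn f e e.source ∧
      ∀ (h : M → F) (D₁ : E2 →L[ℝ] F),
        HasStrictFDerivAt (h ∘ (chartAt E2 x).symm) D₁ (chartAt E2 x x) →
        ∃ D₂ : E2 →L[ℝ] F, HasFDerivAt (h ∘ e.symm) D₂ (f x) ∧ ∀ v, D₂ (D v) = D₁ v := by
  set φ := chartAt E2 x with hφ
  set D' : E2 ≃L[ℝ] E2 := (LinearEquiv.ofInjectiveEndo D.toLinearMap hD).toContinuousLinearEquiv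
    with hD'
  have hDD : (D' : E2 →L[ℝ] E2) = D := by ext1 v; rfl
  have hf' : HasStrictFDerivAt (f ∘ φ.symm) (D' : E2 →L[ℝ] E2) (φ x) := by rwa [hDD]
  have hx : φ.symm (φ x) = x := φ.left_inv (mem_chart_source E2 x)
  set Ψ := hf'.toOpenPartialHomeomorph with hΨ
  have hc : ∀ z, Ψ z = f (φ.symm z) := fun z => rfl
  refine ⟨φ.trans Ψ, ?_, ?_, ?_⟩
  · rw [OpenPartialHomeomorph.trans_source]
    exact ⟨mem_chart_source E2 x, hf'.mem_toOpenPartialHomeomorph_source⟩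
  · intro y hy
    rw [OpenPartialHomeomorph.trans_source] at hy
    rw [OpenPartialHomeomorph.coe_trans, Function.comp_apply, hc, φ.left_inv hy.1]
  · intro h D₁ hh
    refine ⟨D₁.comp (D'.symm : E2 →L[ℝ] E2), ?_, fun v => ?_⟩
    · have h1 := hf'.to_localInverse
      have h2 : hf'.localInverse (f ∘ φ.symm) D' (φ x) ((f ∘ φ.symm) (φ x)) = φ x :=
        hf'.localInverse_apply_image
      rw [← h2] at hh
      have h3 := hh.hasFDerivAt.comp _ h1.hasFDerivAt
      rw [Function.comp_apply, hx] at h3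
      exact h3
    · change D₁ (D'.symm (D v)) = D₁ v
      rw [← hDD]
      simp

end Charts

/-! ### First-order data of a maximal surface. -/

namespace SpacelikeSurface

open Filter Topology

variable {M : Type*} [TopologicalSpace M] [ChartedSpace E2 M] [IsManifold 𝓘(ℝ, E2) ∞ M]

/-- The second fundamental form is symmetric. -/
theorem form_dN_symm (S : SpacelikeSurface M) (x : M) (v w : TangentSpace 𝓘(ℝ, E2) x) :
    form (S.dN x v) (S.dσ x w) = form (S.dN x w) (S.dσ x v) := by
  set φ := chartAt E2 x with hφ
  have hσ := contDiffAt_chart S.smooth_σ x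
  have hN := hasStrictFDerivAt_chart S.smooth_N x
  obtain ⟨A, hσ', hA⟩ : ∃ A : E2 →L[ℝ] R22, HasStrictFDerivAt (S.σ ∘ φ.symm) A (φ x) ∧
      ∀ v, A v = S.dσ x v := ⟨_, hasStrictFDerivAt_chart S.smooth_σ x, fun _ => rfl⟩
  have hsymm : IsSymmSndFDerivAt ℝ (S.σ ∘ φ.symm) (φ x) := hσ.isSymmSndFDerivAt (by
    rw [minSmoothness_of_isRCLikeNormedField]; norm_cast)
  have hd2 : HasStrictFDerivAt (fderiv ℝ (S.σ ∘ φ.symm)) (fderiv ℝ (fderiv ℝ (S.σ ∘ φ.symm)) (φ x))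
      (φ x) := by
    have : ContDiffAt ℝ 1 (fderiv ℝ (S.σ ∘ φ.symm)) (φ x) :=
      hσ.fderiv_right (m := 1) (by norm_cast)
    exact this.hasStrictFDerivAt (by simp)
  have h6 : φ.symm (φ x) = x := φ.left_inv (mem_chart_source E2 x)
  have key : ∀ v w : E2, form (S.dN x v) (S.dσ x w) =
      -form (S.N x) (fderiv ℝ (fderiv ℝ (S.σ ∘ φ.symm)) (φ x) v w) := by
    intro v w
    have h1 : HasStrictFDerivAt (fun z => fderiv ℝ (S.σ ∘ φ.symm) z w)
        ((fderiv ℝ (fderiv ℝ (S.σ ∘ φ.symm)) (φ x)).flip w) (φ x) := by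
      simpa using hd2.clm_apply (hasStrictFDerivAt_const w (φ x))
    obtain ⟨D, h2, hD⟩ := hasStrictFDerivAt_bilinear formL hN h1
    -- Differentiating `⟨N, dσ(w)⟩ = 0` in the direction `v` expresses `⟨dN(v), dσ(w)⟩` by the
    -- second derivative of `σ`, which is symmetric.
    have h3 : (fun z => formL ((S.N ∘ φ.symm) z) (fderiv ℝ (S.σ ∘ φ.symm) z w)) =ᶠ[𝓝 (φ x)]
        fun _ => (0 : ℝ) := by
      filter_upwards [φ.open_target.mem_nhds (mem_chart_target E2 x)] with z hz
      obtain ⟨u, hu⟩ := fderiv_chart_apply S.smooth_σ x hz w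
      rw [hu]
      exact S.normal_orthogonal _ u
    have h4 := h2.hasFDerivAt.unique
      ((hasFDerivAt_const (0 : ℝ) (φ x)).congr_of_eventuallyEq h3)
    have h5 := hD v
    rw [h4, hσ'.hasFDerivAt.fderiv, Function.comp_apply, h6, hA] at h5
    have h7 : 0 = form (S.N x) (fderiv ℝ (fderiv ℝ (S.σ ∘ φ.symm)) (φ x) v w) +
      form (S.dN x v) (S.dσ x w) := h5
    linarith
  rw [key v w, key w v, hsymm.eq v w]

/-- Differentiation of a constant scalar product. -/
theorem form_deriv_const {f g : M → R22} (hf : ContMDiff 𝓘(ℝ, E2) 𝓘(ℝ, R22) ∞ f)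
    (hg : ContMDiff 𝓘(ℝ, E2) 𝓘(ℝ, R22) ∞ g) {c : ℝ} (h : ∀ x, form (f x) (g x) = c) (x : M)
    (v : TangentSpace 𝓘(ℝ, E2) x) :
    form (f x) (mfderiv 𝓘(ℝ, E2) 𝓘(ℝ, R22) g x v) +
      form (mfderiv 𝓘(ℝ, E2) 𝓘(ℝ, R22) f x v) (g x) = 0 := by
  set φ := chartAt E2 x with hφ
  obtain ⟨D, h2, hD⟩ := hasStrictFDerivAt_bilinear formL (hasStrictFDerivAt_chart hf x)
    (hasStrictFDerivAt_chart hg x)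
  have h3 : (fun z => formL ((f ∘ φ.symm) z) ((g ∘ φ.symm) z)) = fun _ => c := by
    ext z; exact h _
  rw [h3] at h2
  have h4 := h2.hasFDerivAt.unique (hasFDerivAt_const c (φ x))
  have h5 := hD v
  have h6 : φ.symm (φ x) = x := φ.left_inv (mem_chart_source E2 x)
  rw [h4, Function.comp_apply, Function.comp_apply, h6] at h5
  exact h5.symm

theorem pointData (S : SpacelikeSurface M) (hS : S.IsMaximal) (x : M) :
    PointData (S.σ x) (S.N x) (S.dσ x) (S.dN x) (S.shapeOperator x) := by
  have hBn : ∀ v, form (S.dN x v) (S.N x) = 0 := fun v => by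
    have : form (S.N x) (S.dN x v) + form (S.dN x v) (S.N x) = 0 :=
      form_deriv_const S.smooth_N S.smooth_N S.normal_unit x v
    rw [form_comm (S.N x)] at this
    linarith
  have hAs : ∀ v, form (S.dσ x v) (S.σ x) = 0 := fun v => by
    have : form (S.σ x) (S.dσ x v) + form (S.dσ x v) (S.σ x) = 0 :=
      form_deriv_const S.smooth_σ S.smooth_σ S.mem x v
    rw [form_comm (S.σ x)] at this
    linarith
  have hBs : ∀ v, form (S.dN x v) (S.σ x) = 0 := fun v => by
    have : form (S.N x) (S.dσ x v) + form (S.dN x v) (S.σ x) = 0 :=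
      form_deriv_const S.smooth_N S.smooth_σ S.normal_tangent_AdS x v
    have h2 : form (S.N x) (S.dσ x v) = 0 := S.normal_orthogonal x v
    linarith
  have hrange : ∀ w, form w (S.σ x) = 0 → form w (S.N x) = 0 → ∃ v, S.dσ x v = w := by
    intro w h1 h2
    have : w ∈ S.tangentPlane x := by rw [tangentPlane_eq]; exact h2
    obtain ⟨a, ha, b, ⟨v, rfl⟩, hab⟩ := Submodule.mem_sup.1 this
    obtain ⟨c, rfl⟩ := Submodule.mem_span_singleton.1 ha
    have hσ : form (S.σ x) (S.σ x) = -1 := S.mem x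
    rw [← hab, form_add_left, form_smul_left, hσ, hAs] at h1
    obtain rfl : c = 0 := by linarith
    exact ⟨v, by rw [← hab, zero_smul, zero_add]⟩
  have hpos : ∀ v, v ≠ 0 → 0 < form (S.dσ x v) (S.dσ x v) := S.spacelike x
  have hinj : LinearMap.ker (S.dσ x) = ⊥ := by
    rw [LinearMap.ker_eq_bot, injective_iff_map_eq_zero]
    intro v hv
    by_contra hne
    have := hpos v hne
    rw [hv] at this
    simp [form] at this
  have hAW : ∀ v, S.dσ x (S.shapeOperator x v) = S.dN x v := by
    intro v
    obtain ⟨u, hu⟩ := hrange (S.dN x v) (hBs v) (hBn v)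
    have h1 : S.shapeOperator x v =
        (S.dσ x).leftInverse (S.dN x v + form (S.dN x v) (S.σ x) • S.σ x) := rfl
    rw [h1, hBs, zero_smul, add_zero, ← hu, LinearMap.leftInverse_apply_of_inj hinj]
  refine ⟨S.mem x, S.normal_unit x, S.normal_tangent_AdS x, hAs, fun v => ?_, hBs, hBn,
    S.form_dN_symm x, hpos, hrange, hAW, hS x⟩
  rw [form_comm]; exact S.normal_orthogonal x v

end SpacelikeSurface

/-! ### Entire surfaces: closedness and bijectivity. -/

open Set Filter Topology

/-- If the values of `D` are tangent and spacelike, then `D` is injective in coordinates. -/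
theorem coordL_comp_injective {h : R22} (hh : h ∈ Hyp) {D : E2 →L[ℝ] R22}
    (ht : ∀ v, form (D v) h = 0 ∧ D v 2 = 0) (hpos : ∀ v, v ≠ 0 → 0 < form (D v) (D v)) :
    Function.Injective (coordL.comp D) := by
  rw [injective_iff_map_eq_zero]
  intro v hv
  by_contra hne
  have h0 : D v = 0 := by
    refine tangent_ext hh (ht v).1 (ht v).2 (by simp [form]) rfl ?_
    rw [map_zero]; exact hv
  have := hpos v hne
  rw [h0] at this
  simp [form] at this

theorem exists_eq_of_tangent {h : R22} (hh : h ∈ Hyp) {D : E2 →L[ℝ] R22}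
    (ht : ∀ v, form (D v) h = 0 ∧ D v 2 = 0) (hpos : ∀ v, v ≠ 0 → 0 < form (D v) (D v))
    {w : R22} (hw : form w h = 0) (hw2 : w 2 = 0) : ∃ v, D v = w := by
  obtain ⟨v, hv⟩ := LinearMap.surjective_of_injective (f := (coordL.comp D).toLinearMap)
    (coordL_comp_injective hh ht hpos) (coordL w)
  exact ⟨v, tangent_ext hh (ht v).1 (ht v).2 hw hw2 hv⟩

theorem form_le_norm_coordL_sq (w : R22) : form w w ≤ ‖coordL w‖ ^ 2 := by
  rw [EuclideanSpace.norm_sq_eq, Fin.sum_univ_two]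
  simp only [coordL_zero, coordL_one, Real.norm_eq_abs, sq_abs, form]
  nlinarith [sq_nonneg (w 2), sq_nonneg (w 3)]

theorem continuous_mk : Continuous fun v : {v : R22 // v ≠ 0} => Projectivization.mk ℝ v.1 v.2 :=
  continuous_coinduced_rng

namespace SpacelikeSurface

variable {M : Type*} [TopologicalSpace M] [ChartedSpace E2 M] [IsManifold 𝓘(ℝ, E2) ∞ M]

theorem isEmbedding_σ (S : SpacelikeSurface M) : IsEmbedding S.σ := by
  have h : IsEmbedding (fun x => (⟨S.σ x, ne_zero_of_mem (S.mem x)⟩ : {v : R22 // v ≠ 0})) :=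
    IsEmbedding.of_comp (S.smooth_σ.continuous.subtype_mk _) continuous_mk S.embedding
  exact IsEmbedding.subtypeVal.comp h

/-- A limit `p` of points of the lift still has square `-1`, so `[p]` is not at infinity and by
entireness is a point of the surface, say the image of `x`. As the surface is embedded in projective
space, the points approaching `p` converge to `x` in `M`, so `p` is `σ x` and not its opposite. -/
theorem IsEntire.isClosedEmbedding {S : SpacelikeSurface M} (hS : S.IsEntire) :
    IsClosedEmbedding S.σ := by
  refine ⟨S.isEmbedding_σ, isClosed_of_closure_subset fun p hp => ?_⟩
  have hcl : IsClosed {x : R22 | form x x = -1} :=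
    isClosed_eq (by simp only [form]; fun_prop) continuous_const
  have hform : form p p = -1 := closure_minimal (by rintro _ ⟨x, rfl⟩; exact S.mem x) hcl hp
  have hp0 : p ≠ 0 := ne_zero_of_mem hform
  have hne : NeBot (comap S.σ (𝓝 p)) := by
    rw [mem_closure_iff_comap_neBot] at hp
    have := hp
    rw [comap_neBot_iff] at this ⊢
    intro t ht
    obtain ⟨⟨_, x, rfl⟩, hx⟩ := this t ht
    exact ⟨x, hx⟩
  have hlim : Tendsto S.σ (comap S.σ (𝓝 p)) (𝓝 p) := tendsto_comap
  have hlim' : Tendsto (fun x => Projectivization.mk ℝ (S.σ x) (ne_zero_of_mem (S.mem x)))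
      (comap S.σ (𝓝 p)) (𝓝 (Projectivization.mk ℝ p hp0)) := by
    have : Tendsto (fun x => (⟨S.σ x, ne_zero_of_mem (S.mem x)⟩ : {v : R22 // v ≠ 0}))
        (comap S.σ (𝓝 p)) (𝓝 ⟨p, hp0⟩) := by
      rw [tendsto_subtype_rng]; exact hlim
    exact (continuous_mk.tendsto _).comp this
  have hmem : Projectivization.mk ℝ p hp0 ∈ closure S.image :=
    mem_closure_of_tendsto hlim' (Eventually.of_forall fun x => ⟨x, rfl⟩)
  have himage : Projectivization.mk ℝ p hp0 ∈ S.image := by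
    by_contra hnot
    have hb : form (Projectivization.mk ℝ p hp0).rep (Projectivization.mk ℝ p hp0).rep = 0 :=
      hS.2 ⟨hmem, hnot⟩
    obtain ⟨a, ha⟩ := Projectivization.exists_smul_eq_mk_rep ℝ p hp0
    rw [← ha] at hb
    have : form ((a : ℝ) • p) ((a : ℝ) • p) = 0 := hb
    rw [form_smul_left, form_smul_right, hform] at this
    have ha0 : (a : ℝ) ≠ 0 := a.ne_zero
    have : (a : ℝ) * a = 0 := by linarith
    simp [ha0] at this
  obtain ⟨x, hx⟩ := himage
  have hle : comap S.σ (𝓝 p) ≤ 𝓝 x := by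
    rw [S.embedding.isInducing.nhds_eq_comap, ← tendsto_iff_comap]
    have hx : Projectivization.mk ℝ (S.σ x) (ne_zero_of_mem (S.mem x)) =
      Projectivization.mk ℝ p hp0 := hx
    rwa [hx]
  exact ⟨x, tendsto_nhds_unique ((S.smooth_σ.continuous.tendsto x).mono_left hle) hlim⟩

theorem IsEntire.connectedSpace {S : SpacelikeSurface M} (hS : S.IsEntire) : ConnectedSpace M := by
  obtain ⟨⟨φ⟩, -⟩ := hS
  have : ConnectedSpace (Metric.ball (0 : E2) 1) :=
    isConnected_iff_connectedSpace.1 ((convex_ball _ _).isPathConnected (by simp)).isConnected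
  exact φ.symm.surjective.connectedSpace φ.symm.continuous

/-- A map to the hyperbolic plane that contracts lengths by a bounded amount is bijective if the
surface is entire. -/
theorem IsEntire.bijective {S : SpacelikeSurface M} (hS : S.IsEntire) {g : M → R22}
    (hg : ∀ x, g x ∈ Hyp) {k : ℝ} (hk : k < 1)
    (hD : ∀ x, ∃ D : E2 →L[ℝ] R22,
      HasStrictFDerivAt (g ∘ (chartAt E2 x).symm) D (chartAt E2 x x) ∧
      (∀ v, form (D v) (g x) = 0 ∧ D v 2 = 0) ∧
      ∀ v : E2, (1 - k) ^ 2 * form (S.dσ x v) (S.dσ x v) ≤ form (D v) (D v))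
    (hb : ∀ x v, ‖S.dσ x v‖ ≤ 4 * ‖S.σ x‖ * (g x 3 * √(form (S.dσ x v) (S.dσ x v)))) :
    Function.Bijective (fun x => coordL (g x)) := by
  have := hS.connectedSpace
  have hcl := hS.isClosedEmbedding
  have := hcl.isEmbedding.t2Space
  have hk' : 0 < 1 - k := by linarith
  -- The root is the last coordinate of the point of `Hyp` over `z`, the 4 comes from `hb`, and `1 /
  -- (1 - k)` from the lower bound for the differential.
  set K : E2 → ℝ := fun z => 4 * √(1 + z 0 ^ 2 + z 1 ^ 2) / (1 - k) with hK
  refine HasGrowth.bijective (σ := S.σ) (K := K) (fun x => ?_) hcl (by fun_prop)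
  obtain ⟨D, hD1, ht, hq⟩ := hD x
  have hpos : ∀ v, v ≠ 0 → 0 < form (D v) (D v) := fun v hv =>
    lt_of_lt_of_le (mul_pos (pow_pos hk' 2) (S.spacelike x v hv)) (hq v)
  have hinj := coordL_comp_injective (hg x) ht hpos
  obtain ⟨e, hx, he, hinv⟩ := exists_local_inverse (F := R22) (f := fun x => coordL (g x))
    (coordL.hasStrictFDerivAt.comp _ hD1) hinj
  obtain ⟨A, hA, hAv⟩ : ∃ A : E2 →L[ℝ] R22, HasStrictFDerivAt (S.σ ∘ (chartAt E2 x).symm) A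
      (chartAt E2 x x) ∧ ∀ v, A v = S.dσ x v :=
    ⟨_, hasStrictFDerivAt_chart S.smooth_σ x, fun _ => rfl⟩
  obtain ⟨D₂, hD₂, hD₂v⟩ := hinv S.σ A hA
  refine ⟨e, hx, he, D₂, hD₂, ?_⟩
  have h3 : √(1 + coordL (g x) 0 ^ 2 + coordL (g x) 1 ^ 2) = g x 3 := by
    rw [coordL_zero, coordL_one, ← Hyp.sq (hg x), Real.sqrt_sq (hg x).2.2.le]
  have hg3 := (hg x).2.2
  refine D₂.opNorm_le_bound (by positivity) fun w => ?_
  obtain ⟨v, rfl⟩ := LinearMap.surjective_of_injective (f := (coordL.comp D).toLinearMap) hinj w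
  change ‖D₂ (coordL.comp D v)‖ ≤ _ * ‖coordL.comp D v‖
  rw [hD₂v, hAv, hK]
  simp only [h3]
  have h4 : √(form (S.dσ x v) (S.dσ x v)) ≤ ‖coordL.comp D v‖ / (1 - k) := by
    apply Real.sqrt_le_iff.2
    refine ⟨by positivity, ?_⟩
    rw [div_pow, le_div_iff₀ (by positivity), mul_comm]
    exact (hq v).trans (form_le_norm_coordL_sq (D v))
  calc ‖S.dσ x v‖ ≤ 4 * ‖S.σ x‖ * (g x 3 * √(form (S.dσ x v) (S.dσ x v))) := hb x v
    _ ≤ 4 * ‖S.σ x‖ * (g x 3 * (‖coordL.comp D v‖ / (1 - k))) := by gcongr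
    _ = _ := by field_simp

theorem hasStrictFDerivAt_left (S : SpacelikeSurface M) (x : M) : ∃ D : E2 →L[ℝ] R22,
    HasStrictFDerivAt ((fun y => qmul (qconj (S.N y)) (S.σ y)) ∘ (chartAt E2 x).symm) D
      (chartAt E2 x x) ∧ ∀ v, D v = leftDiff (S.σ x) (S.N x) (S.dσ x v) (S.dN x v) := by
  obtain ⟨D, hD, hDv⟩ := hasStrictFDerivAt_bilinear qmulL
    (qconjL.hasStrictFDerivAt.comp _ (hasStrictFDerivAt_chart S.smooth_N x))
    (hasStrictFDerivAt_chart S.smooth_σ x)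
  have h6 : (chartAt E2 x).symm (chartAt E2 x x) = x :=
    (chartAt E2 x).left_inv (mem_chart_source E2 x)
  refine ⟨D, hD, fun v => ?_⟩
  rw [hDv]
  simp only [Function.comp_apply]
  rw [h6]
  rfl

theorem hasStrictFDerivAt_right (S : SpacelikeSurface M) (x : M) : ∃ D : E2 →L[ℝ] R22,
    HasStrictFDerivAt ((fun y => qmul (S.σ y) (qconj (S.N y))) ∘ (chartAt E2 x).symm) D
      (chartAt E2 x x) ∧ ∀ v, D v = rightDiff (S.σ x) (S.N x) (S.dσ x v) (S.dN x v) := by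
  obtain ⟨D, hD, hDv⟩ := hasStrictFDerivAt_bilinear qmulL
    (hasStrictFDerivAt_chart S.smooth_σ x)
    (qconjL.hasStrictFDerivAt.comp _ (hasStrictFDerivAt_chart S.smooth_N x))
  have h6 : (chartAt E2 x).symm (chartAt E2 x x) = x :=
    (chartAt E2 x).left_inv (mem_chart_source E2 x)
  refine ⟨D, hD, fun v => ?_⟩
  rw [hDv]
  simp only [Function.comp_apply]
  rw [h6, add_comm]
  rfl

theorem IsEntire.bijective_left {S : SpacelikeSurface M} (hE : S.IsEntire) (hS : S.IsMaximal)
    (ho : S.IsOriented) {lam : M → ℝ} (hlam : ∀ x, (S.shapeOperator x).HasEigenvalue (lam x))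
    {k : ℝ} (hk : k < 1) (hlk : ∀ x, |lam x| ≤ k) (p₀ : AdSHat) :
    Function.Bijective (S.leftMap p₀) := by
  have h := hE.bijective (g := fun y => qmul (qconj (S.N y)) (S.σ y)) ho hk (fun x => ?_)
    (fun x v => ?_)
  · have hp : form p₀.1 p₀.1 = -1 := p₀.2
    refine ⟨fun a b hab => h.1 ?_, fun y => ?_⟩
    · have := congrArg (fun z : plane p₀ => qmul (qconj p₀) z) hab
      simp only [ho.leftMap_eq, qconj_qmul_cancel hp] at this
      exact congrArg coordL this
    · obtain ⟨x, hx⟩ := h.2 (coordL (qmul (qconj p₀) y))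
      refine ⟨x, Subtype.ext ?_⟩
      rw [ho.leftMap_eq, coordL_injOn (ho x) (qconj_mem_of_plane hp y.2) hx, qmul_qconj_cancel hp]
  · obtain ⟨D, hD, hDv⟩ := S.hasStrictFDerivAt_left x
    have hP := S.pointData hS x
    refine ⟨D, hD, fun v => by rw [hDv]; exact hP.leftDiff_tangent v, fun v => ?_⟩
    rw [hDv]
    refine le_trans ?_ ((hP.bounds (hlam x)).1 v)
    have h1 := hlk x
    refine mul_le_mul_of_nonneg_right ?_ (hP.nonneg v)
    gcongr
  · have hP := S.pointData hS x
    exact norm_le_left hP.hs hP.hns (ho x) (hP.As v) (hP.An v)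

theorem IsEntire.bijective_right {S : SpacelikeSurface M} (hE : S.IsEntire) (hS : S.IsMaximal)
    (ho : S.IsOriented) {lam : M → ℝ} (hlam : ∀ x, (S.shapeOperator x).HasEigenvalue (lam x))
    {k : ℝ} (hk : k < 1) (hlk : ∀ x, |lam x| ≤ k) (p₀ : AdSHat) :
    Function.Bijective (S.rightMap p₀) := by
  have h := hE.bijective (g := fun y => qmul (S.σ y) (qconj (S.N y))) ho.mem_right hk (fun x => ?_)
    (fun x v => ?_)
  · have hp : form p₀.1 p₀.1 = -1 := p₀.2
    refine ⟨fun a b hab => h.1 ?_, fun y => ?_⟩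
    · have := congrArg (fun z : plane p₀ => qmul z (qconj p₀)) hab
      simp only [ho.rightMap_eq, qmul_qconj_cancel_right hp] at this
      exact congrArg coordL this
    · obtain ⟨x, hx⟩ := h.2 (coordL (qmul y (qconj p₀)))
      refine ⟨x, Subtype.ext ?_⟩
      rw [ho.rightMap_eq, coordL_injOn (ho.mem_right x) (mem_qconj_of_plane hp y.2) hx,
        qconj_qmul_cancel_right hp]
  · obtain ⟨D, hD, hDv⟩ := S.hasStrictFDerivAt_right x
    have hP := S.pointData hS x
    refine ⟨D, hD, fun v => by rw [hDv]; exact hP.rightDiff_tangent v, fun v => ?_⟩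
    rw [hDv]
    refine le_trans ?_ ((hP.bounds (hlam x)).2.1 v)
    have h1 := hlk x
    refine mul_le_mul_of_nonneg_right ?_ (hP.nonneg v)
    gcongr
  · have hP := S.pointData hS x
    exact norm_le_right hP.hs hP.hns (ho.mem_right x) (hP.As v) (hP.An v)

end SpacelikeSurface

/-! ### Differential and distortion of `Φ`. -/

open Set Filter Topology

theorem extendPlane_apply {p₀ : AdSHat} (Φ : plane p₀ → plane p₀) (y : plane p₀) :
    extendPlane Φ y = Φ y :=
  Subtype.val_injective.extend_apply _ _ _

theorem dilatation_eq {t : ℝ} (h0 : 0 ≤ t) (h1 : t < 1) :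
    ENNReal.ofReal (((1 + t) / (1 - t)) ^ 2) =
      ((1 + ENNReal.ofReal t) / (1 - ENNReal.ofReal t)) ^ 2 := by
  rw [ENNReal.ofReal_pow (div_nonneg (by linarith) (by linarith)),
    ENNReal.ofReal_div_of_pos (by linarith), ENNReal.ofReal_add zero_le_one h0,
    ENNReal.ofReal_sub _ h0, ENNReal.ofReal_one]

/-- A monotone function continuous at a supremum commutes with it. In `ℝ≥0∞`, truncated subtraction
keeps `t ↦ ((1+t)/(1-t))²` monotone beyond `1`, and division by zero gives the value `∞` at `1`,
where it is still continuous. -/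
theorem iSup_dilatation {ι : Type*} [Nonempty ι] {lam : ι → ℝ} (h : ∀ i, |lam i| < 1) :
    ⨆ i, ENNReal.ofReal (((1 + |lam i|) / (1 - |lam i|)) ^ 2) =
      ((1 + supNorm lam) / (1 - supNorm lam)) ^ 2 := by
  have hle : supNorm lam ≤ 1 := iSup_le fun i => by
    rw [← ENNReal.ofReal_one]
    exact ENNReal.ofReal_le_ofReal (h i).le
  have hcont : ContinuousAt (fun t : ℝ≥0∞ => ((1 + t) / (1 - t)) ^ 2) (supNorm lam) := by
    have h1 : Tendsto (fun t : ℝ≥0∞ => 1 + t) (𝓝 (supNorm lam)) (𝓝 (1 + supNorm lam)) :=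
      tendsto_const_nhds.add tendsto_id
    have h2 : Tendsto (fun t : ℝ≥0∞ => 1 - t) (𝓝 (supNorm lam)) (𝓝 (1 - supNorm lam)) :=
      (ENNReal.continuous_sub_left ENNReal.one_ne_top).tendsto _
    refine ENNReal.Tendsto.pow (ENNReal.Tendsto.div h1 (Or.inl ?_) h2 (Or.inr ?_))
    · simp
    · exact ENNReal.add_ne_top.2 ⟨ENNReal.one_ne_top, ne_top_of_le_ne_top ENNReal.one_ne_top hle⟩
  have hmono : Monotone (fun t : ℝ≥0∞ => ((1 + t) / (1 - t)) ^ 2) := fun a b hab => by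
    dsimp only
    gcongr
  have := hmono.map_ciSup_of_continuousAt (g := fun i => ENNReal.ofReal |lam i|) hcont
  rw [show ((1 + supNorm lam) / (1 - supNorm lam)) ^ 2 =
    ⨆ i, ((1 + ENNReal.ofReal |lam i|) / (1 - ENNReal.ofReal |lam i|)) ^ 2 from this]
  exact iSup_congr fun i => dilatation_eq (abs_nonneg _) (h i)

theorem plane_nonempty (p₀ : AdSHat) : Nonempty (plane p₀) :=
  ⟨⟨_, qmul_mem_plane_left p₀.2 qrot_mem_Hyp⟩⟩

namespace SpacelikeSurface

variable {M : Type*} [TopologicalSpace M] [ChartedSpace E2 M] [IsManifold 𝓘(ℝ, E2) ∞ M]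

section Distortion

variable {S : SpacelikeSurface M} {p₀ : AdSHat} {Φ : plane p₀ → plane p₀}

/-- The map `Φ` with `Φ ∘ Φ_l = Φ_r` is differentiable where `Φ_l` is an immersion. -/
theorem IsOriented.diffAt (ho : S.IsOriented) (hS : S.IsMaximal)
    (hΦ : ∀ x, Φ (S.leftMap p₀ x) = S.rightMap p₀ x) {x : M} {l : ℝ}
    (hl : (S.shapeOperator x).HasEigenvalue l) (h1 : |l| < 1) : DiffAt Φ (S.leftMap p₀ x) := by
  have hp : form p₀.1 p₀.1 = -1 := p₀.2
  have hP := S.pointData hS x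
  obtain ⟨D, hD, hDv⟩ := S.hasStrictFDerivAt_left x
  obtain ⟨E, hE, -⟩ := S.hasStrictFDerivAt_right x
  have ht : ∀ v, form (D v) (qmul (qconj (S.N x)) (S.σ x)) = 0 ∧ D v 2 = 0 := fun v => by
    rw [hDv]; exact hP.leftDiff_tangent v
  have hpos : ∀ v, v ≠ 0 → 0 < form (D v) (D v) := fun v hv => by
    rw [hDv]
    exact lt_of_lt_of_le (mul_pos (pow_pos (sub_pos.2 h1) 2) (hP.pos v hv)) ((hP.bounds hl).1 v)
  obtain ⟨e, hx, he, hinv⟩ := exists_local_inverse (F := R22)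
    (f := fun y => coordL (qmul (qconj (S.N y)) (S.σ y)))
    (coordL.hasStrictFDerivAt.comp _ hD) (coordL_comp_injective (ho x) ht hpos)
  obtain ⟨D₂, hD₂, -⟩ := hinv _ E hE
  set ψ : R22 →L[ℝ] E2 := coordL.comp (qmulL (qconj p₀)) with hψ
  have hψx : ψ (S.leftMap p₀ x) = coordL (qmul (qconj (S.N x)) (S.σ x)) := by
    change coordL (qmul (qconj p₀) (S.leftMap p₀ x)) = _
    rw [ho.leftMap_eq, qconj_qmul_cancel hp]
  rw [← hψx] at hD₂
  have hG := ((qmulL.flip p₀).hasFDerivAt.comp _ (hD₂.comp _ ψ.hasFDerivAt)).differentiableAt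
    |>.differentiableWithinAt (s := plane p₀)
  -- Near the base point of the plane, `Φ` is the right map after the local inverse of the left map.
  -- Injectivity of `Φ_l` on the whole surface is not needed, because `Φ` is given as a map.
  have key : ∀ w ∈ plane p₀.1, ψ w ∈ e.target →
      extendPlane Φ w = qmul (qmul (S.σ (e.symm (ψ w))) (qconj (S.N (e.symm (ψ w))))) p₀ := by
    intro w hw hwt
    have h2 : coordL (qmul (qconj (S.N (e.symm (ψ w)))) (S.σ (e.symm (ψ w)))) = ψ w := by
      rw [← e.right_inv hwt]
      have := he (e.map_target hwt)
      simpa only [e.right_inv hwt] using this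
    have h3 := coordL_injOn (ho _) (qconj_mem_of_plane hp hw) h2
    have h4 : S.leftMap p₀ (e.symm (ψ w)) = ⟨w, hw⟩ := by
      apply Subtype.ext
      rw [ho.leftMap_eq, h3, qmul_qconj_cancel hp]
    have h5 := extendPlane_apply Φ ⟨w, hw⟩
    rw [← h4, hΦ, ho.rightMap_eq, h4] at h5
    exact h5
  have htarget : ψ (S.leftMap p₀ x) ∈ e.target := by
    rw [hψx, show coordL (qmul (qconj (S.N x)) (S.σ x)) = e x from he hx]
    exact e.map_source hx
  refine hG.congr_of_eventuallyEq ?_ (key _ (S.leftMap p₀ x).2 htarget)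
  filter_upwards [self_mem_nhdsWithin, mem_nhdsWithin_of_mem_nhds
    (ψ.continuous.continuousAt.preimage_mem_nhds (e.open_target.mem_nhds htarget))] with w hw hwt
  exact key w hw hwt

/-- The differential of `Φ` maps the differential of `Φ_l` to the differential of `Φ_r`. -/
theorem IsOriented.fderivWithin_apply (ho : S.IsOriented)
    (hΦ : ∀ x, Φ (S.leftMap p₀ x) = S.rightMap p₀ x) {x : M} (hd : DiffAt Φ (S.leftMap p₀ x))
    (v : E2) :
    fderivWithin ℝ (extendPlane Φ) (plane p₀) (S.leftMap p₀ x)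
      (qmul p₀ (leftDiff (S.σ x) (S.N x) (S.dσ x v) (S.dN x v))) =
      qmul (rightDiff (S.σ x) (S.N x) (S.dσ x v) (S.dN x v)) p₀ := by
  obtain ⟨D, hD, hDv⟩ := S.hasStrictFDerivAt_left x
  obtain ⟨E, hE, hEv⟩ := S.hasStrictFDerivAt_right x
  rw [← hDv, ← hEv]
  set φ := chartAt E2 x with hφ
  have hx : φ.symm (φ x) = x := φ.left_inv (mem_chart_source E2 x)
  have hc : HasDerivAt (fun t : ℝ => φ x + t • v) v 0 := by
    simpa using ((hasDerivAt_id (0 : ℝ)).smul_const v).const_add (φ x)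
  have h0 : φ x + (0 : ℝ) • v = φ x := by simp
  have hL : HasDerivAt (fun t : ℝ => (S.leftMap p₀ (φ.symm (φ x + t • v)) : R22))
      (qmul p₀ (D v)) 0 := by
    rw [← h0] at hD
    have := (qmulL p₀).hasFDerivAt.comp_hasDerivAt _ (hD.hasFDerivAt.comp_hasDerivAt _ hc)
    refine this.congr_of_eventuallyEq (Eventually.of_forall fun t => ?_)
    exact ho.leftMap_eq p₀ _
  have hR : HasDerivAt (fun t : ℝ => (S.rightMap p₀ (φ.symm (φ x + t • v)) : R22))
      (qmul (E v) p₀) 0 := by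
    rw [← h0] at hE
    have := (qmulL.flip p₀).hasFDerivAt.comp_hasDerivAt _ (hE.hasFDerivAt.comp_hasDerivAt _ hc)
    refine this.congr_of_eventuallyEq (Eventually.of_forall fun t => ?_)
    exact ho.rightMap_eq p₀ _
  have hT : HasFDerivWithinAt (extendPlane Φ)
      (fderivWithin ℝ (extendPlane Φ) (plane p₀) (S.leftMap p₀ x)) (plane p₀)
      (S.leftMap p₀ (φ.symm (φ x + (0 : ℝ) • v))) := by
    rw [h0, hx]
    exact DifferentiableWithinAt.hasFDerivWithinAt hd
  -- The curve `Φ_l` of a straight line in the chart stays in the plane, so the chain rule holds for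
  -- whichever derivative within the plane `fderivWithin` selects.
  have h2 := hT.comp_hasDerivAt (0 : ℝ) hL
    (Eventually.of_forall fun t => (S.leftMap p₀ (φ.symm (φ x + t • v))).2)
  have h3 : (extendPlane Φ ∘ fun t : ℝ => (S.leftMap p₀ (φ.symm (φ x + t • v)) : R22)) =
      fun t : ℝ => (S.rightMap p₀ (φ.symm (φ x + t • v)) : R22) := by
    ext1 t
    rw [Function.comp_apply, extendPlane_apply, hΦ]
  rw [h3] at h2
  exact h2.unique hR

theorem IsOriented.distortion_eq (ho : S.IsOriented) (hS : S.IsMaximal)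
    (hΦ : ∀ x, Φ (S.leftMap p₀ x) = S.rightMap p₀ x) {x : M} {l : ℝ}
    (hl : (S.shapeOperator x).HasEigenvalue l) (h1 : |l| < 1) :
    distortion Φ (S.leftMap p₀ x) = ENNReal.ofReal (((1 + |l|) / (1 - |l|)) ^ 2) := by
  have hp : form p₀.1 p₀.1 = -1 := p₀.2
  have hpc : form (qconj p₀.1) (qconj p₀.1) = -1 := by rw [form_qconj, hp]
  have hP := S.pointData hS x
  obtain ⟨D, -, hDv⟩ := S.hasStrictFDerivAt_left x
  obtain ⟨E, -, hEv⟩ := S.hasStrictFDerivAt_right x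
  obtain ⟨hb1, hb2, hb3, ⟨v₁, hv₁, hb4⟩, ⟨v₂, hv₂, hb5⟩⟩ :
      (∀ v : E2, (1 - |l|) ^ 2 * form (S.dσ x v) (S.dσ x v) ≤ form (D v) (D v)) ∧
      (∀ v, (1 - |l|) ^ 2 * form (E v) (E v) ≤ (1 + |l|) ^ 2 * form (D v) (D v)) ∧
      (∀ v, (1 - |l|) ^ 2 * form (D v) (D v) ≤ (1 + |l|) ^ 2 * form (E v) (E v)) ∧
      (∃ v ≠ 0, (1 - |l|) ^ 2 * form (E v) (E v) = (1 + |l|) ^ 2 * form (D v) (D v)) ∧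
      ∃ v ≠ 0, (1 - |l|) ^ 2 * form (D v) (D v) = (1 + |l|) ^ 2 * form (E v) (E v) := by
    simp only [hDv, hEv]
    exact ⟨(hP.bounds hl).1, (hP.bounds hl).2.2⟩
  have ht : ∀ v, form (D v) (qmul (qconj (S.N x)) (S.σ x)) = 0 ∧ D v 2 = 0 := fun v => by
    rw [hDv]; exact hP.leftDiff_tangent v
  have hm : 0 < 1 - |l| := sub_pos.2 h1
  have hl0 : 0 ≤ |l| := abs_nonneg l
  have hpos : ∀ v, v ≠ 0 → 0 < form (D v) (D v) := fun v hv =>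
    lt_of_lt_of_le (mul_pos (pow_pos hm 2) (hP.pos v hv)) (hb1 v)
  have hd := ho.diffAt hS hΦ hl h1
  have hstretch : ∀ v, stretch Φ (S.leftMap p₀ x) (qmul p₀ (D v)) =
      ENNReal.ofReal (√(form (E v) (E v))) := fun v => by
    rw [stretch, hDv, ho.fderivWithin_apply hΦ hd v, ← hEv, form_qmul_right, hp, neg_neg, one_mul]
  -- The differential of `Φ_l` is onto the tangent plane, so unit vectors are parametrized by the
  -- surface, and there the stretch is the length of the right differential.
  have hunit : ∀ w, w ∈ unitTangent p₀ (S.leftMap p₀ x) ↔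
      ∃ v, form (D v) (D v) = 1 ∧ w = qmul p₀ (D v) := by
    intro w
    constructor
    · rintro ⟨hw1, hw2, hw3⟩
      rw [ho.leftMap_eq] at hw1
      obtain ⟨v, hv⟩ := exists_eq_of_tangent (ho x) ht hpos (w := qmul (qconj p₀) w) (by
        have := form_qmul_left (qconj p₀) w (qmul p₀ (qmul (qconj (S.N x)) (S.σ x)))
        rw [qconj_qmul_cancel hp, hw1, mul_zero] at this
        exact this) (by
        have := form_qmul_left (qconj p₀) w p₀
        rw [hw2, mul_zero, qconj_qmul, hp, neg_neg, one_smul, form_qone] at this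
        linarith)
      refine ⟨v, ?_, ?_⟩
      · rw [hv, form_qmul_left, hpc, hw3]; norm_num
      · rw [hv, qmul_qconj_cancel hp]
    · rintro ⟨v, hv, rfl⟩
      refine ⟨?_, ?_, ?_⟩
      · rw [ho.leftMap_eq, form_qmul_left, (ht v).1, mul_zero]
      · have := form_qmul_left p₀ (D v) qone
        rw [qmul_qone, form_qone, (ht v).2, neg_zero, mul_zero] at this
        exact this
      · rw [form_qmul_left, hp, hv]; norm_num
  have hnorm : ∀ v, v ≠ 0 → ∃ c : ℝ, c ≠ 0 ∧ form (D (c • v)) (D (c • v)) = 1 := fun v hv => by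
    have h2 := hpos v hv
    have h3 : 0 < √(form (D v) (D v)) := Real.sqrt_pos.2 h2
    refine ⟨(√(form (D v) (D v)))⁻¹, by positivity, ?_⟩
    rw [map_smul, form_smul_left, form_smul_right]
    nth_rewrite 3 [← Real.mul_self_sqrt h2.le]
    field_simp
  have hsup : ⨆ w ∈ unitTangent p₀ (S.leftMap p₀ x), stretch Φ (S.leftMap p₀ x) w =
      ENNReal.ofReal ((1 + |l|) / (1 - |l|)) := by
    apply le_antisymm
    · refine iSup₂_le fun w hw => ?_
      obtain ⟨v, hv, rfl⟩ := (hunit w).1 hw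
      rw [hstretch]
      apply ENNReal.ofReal_le_ofReal
      rw [Real.sqrt_le_iff]
      refine ⟨by positivity, ?_⟩
      rw [div_pow, le_div_iff₀ (by positivity), mul_comm]
      simpa [hv] using hb2 v
    -- The extremal diagonal from `PointData.bounds`, rescaled to have unit image under the left
    -- differential.
    · obtain ⟨c, hc, hcv⟩ := hnorm v₁ hv₁
      refine le_iSup₂_of_le _ ((hunit _).2 ⟨c • v₁, hcv, rfl⟩) ?_
      rw [hstretch]
      apply ENNReal.ofReal_le_ofReal
      apply Real.le_sqrt_of_sq_le
      rw [div_pow, div_le_iff₀ (by positivity), mul_comm]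
      simp only [map_smul, form_smul_left, form_smul_right] at hcv ⊢
      apply le_of_eq
      linear_combination -(1 + |l|) ^ 2 * hcv - c ^ 2 * hb4
  have hinf : ⨅ w ∈ unitTangent p₀ (S.leftMap p₀ x), stretch Φ (S.leftMap p₀ x) w =
      ENNReal.ofReal ((1 - |l|) / (1 + |l|)) := by
    apply le_antisymm
    · obtain ⟨c, hc, hcv⟩ := hnorm v₂ hv₂
      refine iInf₂_le_of_le _ ((hunit _).2 ⟨c • v₂, hcv, rfl⟩) ?_
      rw [hstretch]
      apply ENNReal.ofReal_le_ofReal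
      rw [Real.sqrt_le_iff]
      refine ⟨by positivity, ?_⟩
      rw [div_pow, le_div_iff₀ (by positivity), mul_comm]
      simp only [map_smul, form_smul_left, form_smul_right] at hcv ⊢
      apply le_of_eq
      linear_combination (1 - |l|) ^ 2 * hcv - c ^ 2 * hb5
    · refine le_iInf₂ fun w hw => ?_
      obtain ⟨v, hv, rfl⟩ := (hunit w).1 hw
      rw [hstretch]
      apply ENNReal.ofReal_le_ofReal
      apply Real.le_sqrt_of_sq_le
      rw [div_pow, div_le_iff₀ (by positivity), mul_comm]
      simpa [hv] using hb3 v
  rw [distortion, hsup, hinf, ← ENNReal.ofReal_div_of_pos (by positivity)]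
  congr 1
  field_simp

end Distortion

/-! ### Orientation -/

/-- The sign of the normal field. -/
noncomputable def normalSign (S : SpacelikeSurface M) (x : M) : ℝ :=
  if 0 < qmul (qconj (S.N x)) (S.σ x) 3 then 1 else -1

theorem normalSign_mul_self (S : SpacelikeSurface M) (x : M) :
    S.normalSign x * S.normalSign x = 1 := by
  rw [normalSign]; split_ifs <;> norm_num

theorem abs_normalSign (S : SpacelikeSurface M) (x : M) : |S.normalSign x| = 1 := by
  rw [normalSign]; split_ifs <;> simp

theorem mem_Hyp_or (S : SpacelikeSurface M) (x : M) :
    qmul (qconj (S.N x)) (S.σ x) ∈ Hyp ∨ -qmul (qconj (S.N x)) (S.σ x) ∈ Hyp := by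
  have hs : form (S.σ x) (S.σ x) = -1 := S.mem x
  have hn := S.normal_unit x
  refine mem_Hyp_or_neg (by rw [form_qmul_left, form_qconj, hn, hs]; norm_num) ?_
  have := S.normal_tangent_AdS x
  simp only [form] at this
  simp [qmul, qconj]
  linarith

/-- The last coordinate of `N⁻¹σ` is continuous and never zero, so its sign is locally constant.
Thus the normal can be made future-directed without assuming `M` connected. -/
theorem normalSign_eventuallyEq (S : SpacelikeSurface M) (x : M) :
    S.normalSign =ᶠ[𝓝 x] fun _ => S.normalSign x := by
  have hc : Continuous fun y => qmul (qconj (S.N y)) (S.σ y) 3 := by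
    have h1 := S.smooth_σ.continuous
    have h2 := S.smooth_N.continuous
    simp only [qmul, qconj, Matrix.cons_val]
    fun_prop
  rcases S.mem_Hyp_or x with h | h
  · filter_upwards [hc.continuousAt.eventually_mem (Ioi_mem_nhds h.2.2)] with y hy
    rw [normalSign, normalSign, if_pos (mem_Ioi.1 hy), if_pos h.2.2]
  · have h3 : qmul (qconj (S.N x)) (S.σ x) 3 < 0 := by simpa using h.2.2
    filter_upwards [hc.continuousAt.eventually_mem (Iio_mem_nhds h3)] with y hy
    rw [normalSign, normalSign, if_neg (not_lt.2 (mem_Iio.1 hy).le), if_neg (not_lt.2 h3.le)]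

theorem mfderiv_normalSign_smul (S : SpacelikeSurface M) (x : M) :
    mfderiv 𝓘(ℝ, E2) 𝓘(ℝ, R22) (fun y => S.normalSign y • S.N y) x =
      S.normalSign x • mfderiv 𝓘(ℝ, E2) 𝓘(ℝ, R22) S.N x := by
  have h1 : (fun y => S.normalSign y • S.N y) =ᶠ[𝓝 x] S.normalSign x • S.N := by
    filter_upwards [S.normalSign_eventuallyEq x] with y hy
    rw [hy]; rfl
  rw [h1.mfderiv_eq]
  exact ((S.smooth_N.mdifferentiable (by simp) x).hasMFDerivAt.const_smul _).mfderiv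

/-- The same surface with the future-directed normal field. -/
noncomputable def orient (S : SpacelikeSurface M) : SpacelikeSurface M :=
  { S with
    N := fun x => S.normalSign x • S.N x
    smooth_N := fun x => by
      have h : ContMDiff 𝓘(ℝ, E2) 𝓘(ℝ, R22) ∞ ((fun _ : M => S.normalSign x) • S.N) :=
        (contMDiff_const : ContMDiff 𝓘(ℝ, E2) 𝓘(ℝ, ℝ) ∞ fun _ : M => S.normalSign x).smul
          S.smooth_N
      refine (h x).congr_of_eventuallyEq ?_
      filter_upwards [S.normalSign_eventuallyEq x] with y hy
      rw [hy]; rfl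
    normal_unit := fun x => by
      rw [form_smul_left, form_smul_right, ← mul_assoc, normalSign_mul_self, S.normal_unit, one_mul]
    normal_tangent_AdS := fun x => by
      rw [form_smul_left, S.normal_tangent_AdS, mul_zero]
    normal_orthogonal := fun x v => by
      refine (form_smul_left _ _ _).trans ?_
      rw [S.normal_orthogonal, mul_zero] }

theorem isOriented_orient (S : SpacelikeSurface M) : S.orient.IsOriented := by
  intro x
  change qmul (qconj (S.normalSign x • S.N x)) (S.σ x) ∈ Hyp
  have h1 : qmul (qconj (S.normalSign x • S.N x)) (S.σ x) =
      S.normalSign x • qmul (qconj (S.N x)) (S.σ x) := by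
    rw [← qmul_smul_left]
    congr 1
    apply ext4 <;> simp [qconj]
  rw [h1]
  rcases S.mem_Hyp_or x with h | h
  · rw [normalSign, if_pos h.2.2, one_smul]; exact h
  · have h3 : qmul (qconj (S.N x)) (S.σ x) 3 < 0 := by simpa using h.2.2
    rw [normalSign, if_neg (not_lt.2 h3.le), neg_one_smul]; exact h

theorem shapeOperator_orient (S : SpacelikeSurface M) (x : M) :
    S.orient.shapeOperator x = S.normalSign x • S.shapeOperator x := by
  have h : S.orient.dN x = S.normalSign x • S.dN x := by
    ext1 v
    exact congrArg (fun T : E2 →L[ℝ] R22 => T v) (S.mfderiv_normalSign_smul x)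
  rw [shapeOperator, shapeOperator, h, LinearMap.comp_smul, LinearMap.comp_smul]
  rfl

theorem IsMaximal.orient {S : SpacelikeSurface M} (hS : S.IsMaximal) : S.orient.IsMaximal := by
  intro x
  rw [shapeOperator_orient, map_smul, hS x, smul_zero]

theorem hasEigenvalue_orient {S : SpacelikeSurface M} {x : M} {l : ℝ}
    (h : (S.shapeOperator x).HasEigenvalue l) :
    (S.orient.shapeOperator x).HasEigenvalue (S.normalSign x * l) := by
  obtain ⟨v, hv⟩ := h.exists_hasEigenvector
  refine Module.End.hasEigenvalue_of_hasEigenvector (x := v)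
    (Module.End.hasEigenvector_iff.2 ⟨Module.End.mem_eigenspace_iff.2 ?_, hv.2⟩)
  rw [shapeOperator_orient, LinearMap.smul_apply, hv.apply_eq_smul, smul_smul]

end SpacelikeSurface

end AdSMaximal

/-! ### The theorem, by reduction to a future-directed normal. -/

open AdSMaximal
theorem mainTheorem12 {M : Type*} [TopologicalSpace M] [ChartedSpace E2 M]
    [IsManifold 𝓘(ℝ, E2) ∞ M] (S : SpacelikeSurface M) (hS : S.IsMaximal)
    (lam : M → ℝ) (hlam : ∀ x, (S.shapeOperator x).HasEigenvalue (lam x)) (p₀ : AdSHat) :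
    (S.IsEntire → supNorm lam < 1 →
      Function.Bijective (S.leftMap p₀) ∧ Function.Bijective (S.rightMap p₀)) ∧
    (∀ Φ : plane p₀ → plane p₀, (∀ x, Φ (S.leftMap p₀ x) = S.rightMap p₀ x) →
      (∀ x, |lam x| < 1 →
        DiffAt Φ (S.leftMap p₀ x) ∧
        distortion Φ (S.leftMap p₀ x) =
          ENNReal.ofReal (((1 + |lam x|) / (1 - |lam x|)) ^ 2)) ∧
      ((∀ x, |lam x| < 1) → Function.Surjective (S.leftMap p₀) →
        maxDilatation Φ = ((1 + supNorm lam) / (1 - supNorm lam)) ^ 2)) := by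
  have ho := S.isOriented_orient
  have hmax := hS.orient
  have hlam' := fun x => SpacelikeSurface.hasEigenvalue_orient (hlam x)
  have habs : ∀ x, |S.normalSign x * lam x| = |lam x| := fun x => by
    rw [abs_mul, S.abs_normalSign, one_mul]
  refine ⟨fun hE hlt => ?_, fun Φ hΦ => ?_⟩
  · have hE' : S.orient.IsEntire := hE
    have hk : (supNorm lam).toReal < 1 := by
      rw [← ENNReal.toReal_one]
      exact (ENNReal.toReal_lt_toReal hlt.ne_top ENNReal.one_ne_top).2 hlt
    have hlk : ∀ x, |S.normalSign x * lam x| ≤ (supNorm lam).toReal := fun x => by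
      rw [habs, ← ENNReal.ofReal_le_iff_le_toReal hlt.ne_top]
      exact le_iSup (fun x => ENNReal.ofReal |lam x|) x
    exact ⟨hE'.bijective_left hmax ho hlam' hk hlk p₀, hE'.bijective_right hmax ho hlam' hk hlk p₀⟩
  · have hΦ' : ∀ x, Φ (S.orient.leftMap p₀ x) = S.orient.rightMap p₀ x := hΦ
    have hdist : ∀ x, |lam x| < 1 → distortion Φ (S.leftMap p₀ x) =
        ENNReal.ofReal (((1 + |lam x|) / (1 - |lam x|)) ^ 2) := fun x hx => by
      have := ho.distortion_eq hmax hΦ' (hlam' x) (by rwa [habs])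
      rwa [habs] at this
    refine ⟨fun x hx => ⟨ho.diffAt hmax hΦ' (hlam' x) (by rwa [habs]), hdist x hx⟩,
      fun hlt hsurj => ?_⟩
    -- Surjectivity onto a nonempty plane excludes the empty surface, for which the supremum of the
    -- distortions would be `0` while the formula gives `1`.
    obtain ⟨x₀, -⟩ := hsurj (plane_nonempty p₀).some
    have : Nonempty M := ⟨x₀⟩
    rw [maxDilatation, ← hsurj.iSup_comp, ← iSup_dilatation hlt]
    exact iSup_congr fun x => hdist x (hlt x)
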